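/- **Setting.** Let $\mathbf G\subset \mathbf{GL}_n$ be a connected semisimple linear algebraic group defined over $\mathbb Q$, let $\mathbf T$ be a maximal $\mathbb Q$-split torus in $\mathbf G$, and let $\{a_t\}_{t\in\mathbb R}$ be a nontrivial (continuous) one-parameter subgroup of $\mathbf T(\mathbb R)$. Let $\mathbf P_0\supset\mathbf T$ be a minimal parabolic $\mathbb Q$-subgroup of $\mathbf G$ and $\overline{\mathbf P}_0$ the opposite minimal parabolic $\mathbb Q$-subgroup with $\mathbf P_0\cap\overline{\mathbf P}_0=Z_{\mathbf G}(\mathbf T)$, chosen so that the stable horospherical subgroup $\{g\in\mathbf G(\mathbb R): a_tga_t^{-1}\to e \text{ as } t\to+\infty\}$ is contained in the unipotent radical $R_u(\mathbf P_0)$ and the unstable horospherical subgroup $\{g\in\mathbf G(\mathbb R): a_tga_t^{-1}\to e\text{ as }t\to-\infty\}$ is contained in $R_u(\overline{\mathbf P}_0)$. Let $\Phi^+$ be the set of positive $\mathbb Q$-roots, i.e. the roots of $\mathbf T$ in the Lie algebra of $\mathbf P_0$. Let $\rho:\mathbf G\to\mathbf{GL}(V)$, $V=\mathbb C^d$, be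 an irreducible representation on the complex vector space $V$, defined over $\mathbb Q$ (with respect to the $\mathbb Q$-structure $\mathbb Q^d$), with $\dim\ker\rho=0$, i.e. with finite kernel. Let $\beta_0$ be the highest weight of $\rho$ relative to $\mathbf T$ for the order determined by $\Phi^+$: it is a weight of $\mathbf T$ in $V$, and for every weight $\beta$ the difference $\beta_0-\beta$ is a sum of elements of $\Phi^+$. A character $\lambda$ of $\mathbf T$ is also regarded as a linear functional on the Lie algebra of $\mathbf T(\mathbb R)$, and $\lambda(a_t)$ denotes its value at the element $tX$, where $a_t=\exp(tX)$; thus $\rho(a_t)v=e^{\beta_0(a_t)}v$ for $v$ in the weight space of $\beta_0$. Fix any norm $\|\cdot\|$ on $V$ and put $\delta(\Lambda)=\inf_{v\in\Lambda\setminus\{0\}}\|v\|$ for a discrete subgroup $\Lambda\subset V$. Let $\psi:(0,\infty)\to(0,\infty)$ be a bounded function and $$\tau(\psi)=\liminf_{t\to\infty}\left(-\frac{\ln\psi(t)}{t}\right)\in[-\infty,\infty].$$ An element $g\in\mathbf G(\mathbb R)$ is called $\psi$-Diophantine if there is a constant $C>0$ such that $\delta(\rho(a_tg)\mathbb Z^d)\ge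 C\,\psi(t)$ for all $t>0$. Let $S_\rho(\psi)\subset\mathbf G(\mathbb R)$ be the set of $\psi$-Diophantine elements and $S_\rho(\psi)^c$ its complement in $\mathbf G(\mathbb R)$. **Theorem.** We have $\tau(\psi)\ge 0$ and $\beta_0(a_{-1})>0$. If $\tau(\psi)>\beta_0(a_{-1})$, then every element of $\mathbf G(\mathbb R)$ is $\psi$-Diophantine, i.e. $S_\rho(\psi)^c=\emptyset$. -/

import Mathlib

open Filter Topology

noncomputable section

/-! Linear algebraic groups are taken in the classical sense: Zariski closed subgroups of `GL_n(ℂ)`,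
together with a field of definition. -/

/-- `S` is the zero locus in `GL_n(ℂ)` of polynomials in the matrix entries with coefficients in `k`.
For `k = ℂ` this is "Zariski closed". For `k = ℚ` it is "closed and defined over `ℚ`"
(`ℚ`-closed and defined over `ℚ` agree, since `ℚ` is perfect). -/
def IsZariskiClosed (k : Type) [Field k] [Algebra k ℂ] {n : ℕ} (S : Set (GL (Fin n) ℂ)) : Prop :=
  ∃ I : Set (MvPolynomial (Fin n × Fin n) k),
    S = {g | ∀ p ∈ I, MvPolynomial.aeval (fun ij : Fin n × Fin n => g.val ij.1 ij.2) p = 0}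

/-- Connectedness for the Zariski topology. -/
def IsZariskiConnected {n : ℕ} (S : Set (GL (Fin n) ℂ)) : Prop :=
  S.Nonempty ∧ ∀ A B : Set (GL (Fin n) ℂ), IsZariskiClosed ℂ A → IsZariskiClosed ℂ B →
    S ⊆ A ∪ B → S ∩ A ∩ B = ∅ → S ⊆ A ∨ S ⊆ B

/-- `N` is a normal subgroup of `H`. -/
def IsNormalIn {n : ℕ} (N H : Subgroup (GL (Fin n) ℂ)) : Prop :=
  N ≤ H ∧ ∀ h ∈ H, ∀ x ∈ N, h * x * h⁻¹ ∈ N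

/-- A connected semisimple group defined over `ℚ`: connected with trivial radical, i.e. the only
closed connected solvable normal subgroup is the trivial one. -/
structure IsConnectedSemisimpleQ {n : ℕ} (G : Subgroup (GL (Fin n) ℂ)) : Prop where
  closed : IsZariskiClosed ℚ (G : Set (GL (Fin n) ℂ))
  connected : IsZariskiConnected (G : Set (GL (Fin n) ℂ))
  radical : ∀ N : Subgroup (GL (Fin n) ℂ), IsNormalIn N G →
    IsZariskiClosed ℂ (N : Set (GL (Fin n) ℂ)) →
    IsZariskiConnected (N : Set (GL (Fin n) ℂ)) → Group.IsSolvable N → N = ⊥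

/-- A `ℚ`-split torus: a connected `ℚ`-group which is diagonalizable over `ℚ`. -/
structure IsSplitTorusQ {n : ℕ} (T : Subgroup (GL (Fin n) ℂ)) : Prop where
  closed : IsZariskiClosed ℚ (T : Set (GL (Fin n) ℂ))
  connected : IsZariskiConnected (T : Set (GL (Fin n) ℂ))
  diagonalizable : ∃ h : GL (Fin n) ℚ, ∀ t ∈ T,
    (Matrix.GeneralLinearGroup.map (algebraMap ℚ ℂ) h * t *
      (Matrix.GeneralLinearGroup.map (algebraMap ℚ ℂ) h)⁻¹).val.IsDiag

/-- `T` is a maximal `ℚ`-split torus in `G`. -/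
def IsMaximalSplitTorusQ {n : ℕ} (G T : Subgroup (GL (Fin n) ℂ)) : Prop :=
  IsSplitTorusQ T ∧ T ≤ G ∧
    ∀ T' : Subgroup (GL (Fin n) ℂ), IsSplitTorusQ T' → T' ≤ G → T ≤ T' → T' = T

/-- A closed connected solvable subgroup of `G`. -/
def IsConnectedSolvableIn {n : ℕ} (G B : Subgroup (GL (Fin n) ℂ)) : Prop :=
  B ≤ G ∧ IsZariskiClosed ℂ (B : Set (GL (Fin n) ℂ)) ∧
    IsZariskiConnected (B : Set (GL (Fin n) ℂ)) ∧ Group.IsSolvable B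

/-- Borel subgroups of `G`: maximal closed connected solvable subgroups. -/
def IsBorelIn {n : ℕ} (G B : Subgroup (GL (Fin n) ℂ)) : Prop :=
  IsConnectedSolvableIn G B ∧
    ∀ B' : Subgroup (GL (Fin n) ℂ), IsConnectedSolvableIn G B' → B ≤ B' → B' = B

/-- Parabolic `ℚ`-subgroups of `G`: subgroups defined over `ℚ` that contain a Borel subgroup. -/
def IsParabolicQ {n : ℕ} (G P : Subgroup (GL (Fin n) ℂ)) : Prop :=
  P ≤ G ∧ IsZariskiClosed ℚ (P : Set (GL (Fin n) ℂ)) ∧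
    ∃ B : Subgroup (GL (Fin n) ℂ), IsBorelIn G B ∧ B ≤ P

/-- Minimal parabolic `ℚ`-subgroups of `G`. -/
def IsMinimalParabolicQ {n : ℕ} (G P : Subgroup (GL (Fin n) ℂ)) : Prop :=
  IsParabolicQ G P ∧ ∀ P' : Subgroup (GL (Fin n) ℂ), IsParabolicQ G P' → P' ≤ P → P' = P

/-- The centralizer `Z(T)` of `T` in `G`. -/
def centralizerIn {n : ℕ} (G T : Subgroup (GL (Fin n) ℂ)) : Subgroup (GL (Fin n) ℂ) :=
  G ⊓ Subgroup.centralizer (T : Set (GL (Fin n) ℂ))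

/-- For a minimal parabolic `ℚ`-subgroup `P` containing `T`, this says that `P'` is the opposite
minimal parabolic `ℚ`-subgroup with the same Levi subgroup `Z(T)`: the two meet exactly in `Z(T)`. -/
def IsOppositeMinimalParabolicQ {n : ℕ} (G T P P' : Subgroup (GL (Fin n) ℂ)) : Prop :=
  IsMinimalParabolicQ G P' ∧ P ⊓ P' = centralizerIn G T

/-- The unipotent radical `R_u(P)`: the subgroup generated by all closed connected normal unipotent
subgroups of `P` (it is itself the largest such subgroup). -/
def unipotentRadical {n : ℕ} (P : Subgroup (GL (Fin n) ℂ)) : Subgroup (GL (Fin n) ℂ) :=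
  sSup {U | IsNormalIn U P ∧ IsZariskiClosed ℂ (U : Set (GL (Fin n) ℂ)) ∧
    IsZariskiConnected (U : Set (GL (Fin n) ℂ)) ∧ ∀ u ∈ U, IsNilpotent (u.val - 1)}

/-- The Lie algebra of `H`, as the Zariski tangent space at the identity inside `M_n(ℂ)`: all `X`
along which the differential at `1` of every polynomial vanishing on `H` is zero. -/
def lieAlg {n : ℕ} (H : Subgroup (GL (Fin n) ℂ)) : Set (Matrix (Fin n) (Fin n) ℂ) :=
  {X | ∀ p : MvPolynomial (Fin n × Fin n) ℂ,
    (∀ g ∈ H, MvPolynomial.eval (fun ij : Fin n × Fin n => g.val ij.1 ij.2) p = 0) →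
    ∑ ij : Fin n × Fin n, MvPolynomial.eval
      (fun ij : Fin n × Fin n => (1 : Matrix (Fin n) (Fin n) ℂ) ij.1 ij.2)
      (MvPolynomial.pderiv ij p) * X ij.1 ij.2 = 0}

/-- `Φ(H)`, the roots in `H` relative to `T`: the nontrivial characters of `T` that occur in the Lie
algebra of `H` under the adjoint action. (Any homomorphism with an eigenvector is a matrix
coefficient, hence a rational character, and it is defined over `ℚ` when `T` is `ℚ`-split.) -/
def rootsIn {n : ℕ} (T H : Subgroup (GL (Fin n) ℂ)) : Set (T →* ℂˣ) :=
  {α | α ≠ 1 ∧ ∃ X ∈ lieAlg H, X ≠ 0 ∧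
    ∀ t : T, (t : GL (Fin n) ℂ).val * X * (t : GL (Fin n) ℂ)⁻¹.val = ((α t : ℂˣ) : ℂ) • X}

/-- `ρ : G → GL_d` is a morphism defined over `ℚ`: its matrix coefficients are polynomials over `ℚ`
in the entries of `g` and `det(g)⁻¹`. -/
def IsRationalQ {n d : ℕ} {G : Subgroup (GL (Fin n) ℂ)} (ρ : G →* GL (Fin d) ℂ) : Prop :=
  ∀ i j : Fin d, ∃ (p : MvPolynomial (Fin n × Fin n) ℚ) (m : ℕ), ∀ g : G,
    (ρ g).val i j =
      MvPolynomial.aeval (fun ij : Fin n × Fin n => (g : GL (Fin n) ℂ).val ij.1 ij.2) p *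
        ((g : GL (Fin n) ℂ).val.det)⁻¹ ^ m

/-- `ρ` is an irreducible representation on the complex vector space `ℂ^d`. -/
def IsIrreducibleRep {n d : ℕ} {G : Subgroup (GL (Fin n) ℂ)} (ρ : G →* GL (Fin d) ℂ) : Prop :=
  0 < d ∧ ∀ W : Submodule ℂ (Fin d → ℂ),
    (∀ g : G, ∀ v ∈ W, (ρ g).val.mulVec v ∈ W) → W = ⊥ ∨ W = ⊤

/-- The weights of `ρ` relative to `T`: the characters of `T` with nonzero weight space. -/
def weights {n d : ℕ} {G T : Subgroup (GL (Fin n) ℂ)} (hTG : T ≤ G) (ρ : G →* GL (Fin d) ℂ) :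
    Set (T →* ℂˣ) :=
  {β | ∃ v : Fin d → ℂ, v ≠ 0 ∧
    ∀ t : T, (ρ (Subgroup.inclusion hTG t)).val.mulVec v = ((β t : ℂˣ) : ℂ) • v}

/-- `β₀` is the highest weight of `ρ` for the order determined by the set `Φp` of positive roots:
`β₀` is a weight, and for every weight `β` the difference of `β₀` and `β` (characters are written
multiplicatively) is a sum of positive roots. -/
def IsHighestWeight {n d : ℕ} {G T : Subgroup (GL (Fin n) ℂ)} (hTG : T ≤ G)
    (ρ : G →* GL (Fin d) ℂ) (Φp : Set (T →* ℂˣ)) (β₀ : T →* ℂˣ) : Prop :=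
  β₀ ∈ weights hTG ρ ∧ ∀ β ∈ weights hTG ρ, β₀ / β ∈ Submonoid.closure Φp

/-- A matrix with real entries. -/
def IsRealPoint {n : ℕ} (g : GL (Fin n) ℂ) : Prop :=
  ∃ g₀ : GL (Fin n) ℝ, Matrix.GeneralLinearGroup.map Complex.ofRealHom g₀ = g

/-- The group of real points `G(ℝ)`, as a subset of `G`. -/
def realPoints {n : ℕ} (G : Subgroup (GL (Fin n) ℂ)) : Set G :=
  {g | IsRealPoint (g : GL (Fin n) ℂ)}

/-- A nontrivial one-parameter subgroup `t ↦ a_t` of `T(ℝ)`. -/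
structure IsOneParameterSubgroup {n : ℕ} {T : Subgroup (GL (Fin n) ℂ)} (a : ℝ → T) : Prop where
  continuous : Continuous a
  map_add : ∀ s t : ℝ, a (s + t) = a s * a t
  real : ∀ t : ℝ, a t ∈ realPoints T
  nontrivial : ∃ t : ℝ, a t ≠ 1

/-- The stable (for `l = atTop`) and unstable (for `l = atBot`) horospherical subgroup in `G(ℝ)`:
all `g` with `a_t g a_t⁻¹ → 1` along `l`. -/
def horospherical {n : ℕ} (G : Subgroup (GL (Fin n) ℂ)) {T : Subgroup (GL (Fin n) ℂ)} (a : ℝ → T)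
    (l : Filter ℝ) : Set (GL (Fin n) ℂ) :=
  {g | g ∈ G ∧ IsRealPoint g ∧
    Tendsto (fun t : ℝ => (a t : GL (Fin n) ℂ) * g * (a t : GL (Fin n) ℂ)⁻¹) l (𝓝 1)}

/-- The value `χ(a_t)` of a character, regarded as a linear functional on the Lie algebra of `T(ℝ)`.
If `a_t = exp (t • X)` then the number `χ (a t)` is `exp (dχ (t • X))`, which is real and positive,
so that the value `dχ (t • X)` is its logarithm. -/
def charValue {n : ℕ} {T : Subgroup (GL (Fin n) ℂ)} (χ : T →* ℂˣ) (t : T) : ℝ :=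
  Real.log ‖((χ t : ℂˣ) : ℂ)‖

/-- The first minimum of `Λ` with respect to the norm `N`. -/
def firstMin {d : ℕ} (N : Seminorm ℂ (Fin d → ℂ)) (Λ : Set (Fin d → ℂ)) : ℝ :=
  sInf (N '' (Λ \ {0}))

/-- The image `h ℤ^d` of the standard lattice. -/
def latticeImage {d : ℕ} (h : GL (Fin d) ℂ) : Set (Fin d → ℂ) :=
  Set.range fun m : Fin d → ℤ => h.val.mulVec fun i => (m i : ℂ)

/-- The set `S_ρ(ψ)` of `ψ`-Diophantine elements of `G(ℝ)`. -/
def diophantineSet {n d : ℕ} {G T : Subgroup (GL (Fin n) ℂ)} (hTG : T ≤ G)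
    (ρ : G →* GL (Fin d) ℂ) (N : Seminorm ℂ (Fin d → ℂ)) (a : ℝ → T) (ψ : ℝ → ℝ) : Set G :=
  {g | g ∈ realPoints G ∧ ∃ C : ℝ, 0 < C ∧ ∀ t : ℝ, 0 < t →
    C * ψ t ≤ firstMin N (latticeImage (ρ (Subgroup.inclusion hTG (a t) * g)))}

/-- `τ(ψ) = liminf_{t → ∞} (- ln ψ(t) / t)`, an extended real number. -/
def tau (ψ : ℝ → ℝ) : EReal :=
  liminf (fun t : ℝ => ((-(Real.log (ψ t) / t) : ℝ) : EReal)) atTop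

end

/-!
The weights and roots are compared along the one-parameter group `a t`.

*Roots.* No root `α` of the minimal parabolic subgroup `P₀` grows along `a t` as `t → +∞`
(`norm_root_le_one`). Otherwise its root space contains a real vector `Y` that `a t` contracts to
zero as `t → -∞`, so that the elements `exp (s • Y)` lie both in `P₀` and in the unstable
horospherical subgroup, which is contained in the opposite parabolic subgroup. Hence they centralize
the torus, whence `Y = 0`. It follows that the highest weight is the smallest of all weights on
`a t` for `t ≥ 0`.

*Weights.* The representation splits over the torus into weight spaces
(`exists_weight_projections`, by linear independence of characters), and the `χ (a t)` are real
exponentials `exp (c χ * t)`. The generator of `ρ (a t)` has trace zero, so that the `c χ` sum to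
zero with multiplicities; they do not all vanish, because `ρ` has finite kernel. Hence some `c χ` is
negative (`exists_weight_neg`), and so is the one of the highest weight. Inverting the action of
`a t` on each weight space bounds the first minimum of the lattice from below by a multiple of
`exp (-b * t)` with `b = β₀ (a (-1))` (`exists_le_firstMin`), and this dominates `ψ` if `b < τ(ψ)`.

*Trace zero* (`trace_toBlocks₂₂_eq_zero`) is where semisimplicity enters, in the form that the
radical is trivial. The Lie algebra used is the tangent space `𝔤` of the graph of `ρ`, whose
elements are pairs `(X, dρ X)`. An element `X` orthogonal to `𝔤` under the trace form
`tr (dρ X * dρ Y)` acts nilpotently: `𝔤` contains the replica of `X` whose eigenvalues are the complex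
conjugates (`eval_exp_replica_eq_zero`), and pairing with it gives the sum of the squared absolute
values of the eigenvalues. By Engel's theorem and irreducibility the trace form is nondegenerate
(`eq_zero_of_mem_traceRadical`). It therefore represents the conjugation-invariant functional
`tr (dρ X)` by an element `Z` of `𝔤` fixed by conjugation. The Zariski closure of the
one-parameter group of `Z` is a closed connected central subgroup, hence trivial
(`IsConnectedSemisimpleQ.eq_zero_of_exp_central`), so that `Z = 0` and the trace vanishes.
-/

noncomputable section
/-! ### Polynomial functions on matrices -/

variable {ι : Type*} [Fintype ι] [DecidableEq ι]

/-- The entries of a matrix, as a point at which polynomials in `ι × ι` variables are evaluated. -/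
def entries {R : Type*} (x : Matrix ι ι R) : ι × ι → R := fun ij => x ij.1 ij.2

theorem hasDerivAt_eval {𝕜 σ : Type*} [NontriviallyNormedField 𝕜] [NormedAlgebra 𝕜 ℂ] [Fintype σ]
    {c : 𝕜 → σ → ℂ} {c' : σ → ℂ} {t : 𝕜} (h : ∀ i, HasDerivAt (fun s => c s i) (c' i) t)
    (p : MvPolynomial σ ℂ) :
    HasDerivAt (fun s => MvPolynomial.eval (c s) p)
      (∑ i, MvPolynomial.eval (c t) (MvPolynomial.pderiv i p) * c' i) t := by
  classical
  induction p using MvPolynomial.induction_on with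
  | C a => simpa using hasDerivAt_const t a
  | add p q hp hq =>
    simp only [map_add, add_mul, Finset.sum_add_distrib]
    exact hp.add hq
  | mul_X p i hp =>
    simp only [map_mul, MvPolynomial.eval_X, Derivation.leibniz, smul_eq_mul, map_add,
      MvPolynomial.pderiv_X]
    have := hp.mul (h i)
    refine this.congr_deriv ?_
    simp only [add_mul, Finset.sum_add_distrib]
    rw [add_comm, Finset.sum_mul]
    congr 1
    · rw [Finset.sum_eq_single i]
      · simp
      · intro j _ hj
        simp [hj.symm]
      · simp
    · exact Finset.sum_congr rfl fun j _ => by ring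

open scoped Matrix.Norms.Operator in
theorem hasDerivAt_exp_entries {𝕜 : Type*} [RCLike 𝕜] [NormedAlgebra 𝕜 ℂ] (A : Matrix ι ι ℂ) (t : 𝕜) :
    ∀ ij, HasDerivAt (fun s : 𝕜 => entries (NormedSpace.exp (s • A)) ij)
      (entries (NormedSpace.exp (t • A) * A) ij) t := fun ij =>
  hasDerivAt_pi.1 ((hasDerivAt_pi
    (φ := fun s : 𝕜 => (NormedSpace.exp (s • A) : Matrix ι ι ℂ))).1
    (hasDerivAt_exp_smul_const A t) ij.1) ij.2

/-- The derivative of the polynomial function `p` along the left invariant vector field `x ↦ x * A`. -/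
def leftInvDeriv (A : Matrix ι ι ℂ) (p : MvPolynomial (ι × ι) ℂ) : MvPolynomial (ι × ι) ℂ :=
  ∑ ij : ι × ι, MvPolynomial.pderiv ij p *
    ∑ k, MvPolynomial.X (ij.1, k) * MvPolynomial.C (A k ij.2)

omit [DecidableEq ι] in
theorem eval_leftInvDeriv (A x : Matrix ι ι ℂ) (p : MvPolynomial (ι × ι) ℂ) :
    MvPolynomial.eval (entries x) (leftInvDeriv A p) =
      ∑ ij, MvPolynomial.eval (entries x) (MvPolynomial.pderiv ij p) * entries (x * A) ij := by
  simp [leftInvDeriv, entries, Matrix.mul_apply]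

theorem hasDerivAt_eval_exp (A : Matrix ι ι ℂ) (p : MvPolynomial (ι × ι) ℂ) (t : ℂ) :
    HasDerivAt (fun s : ℂ => MvPolynomial.eval (entries (NormedSpace.exp (s • A))) p)
      (MvPolynomial.eval (entries (NormedSpace.exp (t • A))) (leftInvDeriv A p)) t := by
  rw [eval_leftInvDeriv]
  exact hasDerivAt_eval (hasDerivAt_exp_entries A t) p

theorem differentiable_eval_exp (A : Matrix ι ι ℂ) (p : MvPolynomial (ι × ι) ℂ) :
    Differentiable ℂ fun s : ℂ => MvPolynomial.eval (entries (NormedSpace.exp (s • A))) p :=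
  fun t => (hasDerivAt_eval_exp A p t).differentiableAt

/-- The polynomial `x ↦ p (g * x * h)`. -/
def translatePoly (g h : Matrix ι ι ℂ) (p : MvPolynomial (ι × ι) ℂ) : MvPolynomial (ι × ι) ℂ :=
  MvPolynomial.bind₁ (fun ij : ι × ι => ∑ k, (∑ l, MvPolynomial.C (g ij.1 l) *
    MvPolynomial.X (l, k)) * MvPolynomial.C (h k ij.2)) p

omit [DecidableEq ι] in
@[simp]
theorem eval_translatePoly (g h x : Matrix ι ι ℂ) (p : MvPolynomial (ι × ι) ℂ) :
    MvPolynomial.eval (entries x) (translatePoly g h p) =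
      MvPolynomial.eval (entries (g * x * h)) p := by
  rw [translatePoly, MvPolynomial.eval, MvPolynomial.eval₂Hom_bind₁]
  congr 1
  congr 1
  ext ij
  simp [entries, Matrix.mul_apply]

/-! ### Tangent spaces at the identity and one-parameter subgroups -/

/-- The Zariski tangent space at the identity of a set of matrices. -/
def tangentSpace (S : Set (Matrix ι ι ℂ)) : Submodule ℂ (Matrix ι ι ℂ) where
  carrier := {X | ∀ p : MvPolynomial (ι × ι) ℂ, (∀ g ∈ S, MvPolynomial.eval (entries g) p = 0) →
    ∑ ij, MvPolynomial.eval (entries (1 : Matrix ι ι ℂ)) (MvPolynomial.pderiv ij p) *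
      entries X ij = 0}
  add_mem' {X Y} hX hY p hp := by
    have h := congrArg₂ (· + ·) (hX p hp) (hY p hp)
    simpa [entries, mul_add, Finset.sum_add_distrib] using h
  zero_mem' p _ := by simp [entries]
  smul_mem' c X hX p hp := by
    have h := congrArg (c * ·) (hX p hp)
    simpa [entries, Finset.mul_sum, mul_left_comm] using h

/-- The velocity at the identity of a differentiable curve inside `S` is tangent to `S`. -/
theorem mem_tangentSpace_of_hasDerivAt {𝕜 : Type*} [NontriviallyNormedField 𝕜] [NormedAlgebra 𝕜 ℂ]
    {S : Set (Matrix ι ι ℂ)} {c : 𝕜 → Matrix ι ι ℂ} {X : Matrix ι ι ℂ} (hc : ∀ t, c t ∈ S)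
    (h0 : c 0 = 1) (h : ∀ ij, HasDerivAt (fun t => entries (c t) ij) (entries X ij) 0) :
    X ∈ tangentSpace S := by
  intro p hp
  have h1 := hasDerivAt_eval h p
  rw [h0] at h1
  refine h1.unique ?_
  simp only [hp _ (hc _)]
  exact hasDerivAt_const _ _

theorem hasDerivAt_eval_of_mem_tangentSpace {S : Set (Matrix ι ι ℂ)} {X : Matrix ι ι ℂ}
    (hX : X ∈ tangentSpace S) {p : MvPolynomial (ι × ι) ℂ}
    (hp : ∀ g ∈ S, MvPolynomial.eval (entries g) p = 0) :
    HasDerivAt (fun s : ℂ => MvPolynomial.eval (entries (1 + s • X)) p) 0 0 := by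
  have h1 : ∀ ij, HasDerivAt (fun s : ℂ => entries (1 + s • X) ij) (entries X ij) 0 := by
    intro ij
    simpa [entries] using ((hasDerivAt_id (0 : ℂ)).mul_const (X ij.1 ij.2)).const_add
      ((1 : Matrix ι ι ℂ) ij.1 ij.2)
  have h2 := hasDerivAt_eval h1 p
  simp only [zero_smul, add_zero] at h2
  rwa [hX p hp] at h2

/-- Two-sided translates `g * X * h` of a tangent vector along elements with `g * h = 1` that
carry `S` into itself are tangent vectors. -/
theorem conj_mem_tangentSpace {S : Set (Matrix ι ι ℂ)} {X g h : Matrix ι ι ℂ}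
    (hX : X ∈ tangentSpace S) (hgh : g * h = 1) (hS : ∀ x ∈ S, g * x * h ∈ S) :
    g * X * h ∈ tangentSpace S := by
  intro p hp
  have h1 := hasDerivAt_eval_of_mem_tangentSpace hX (p := translatePoly g h p) (by
    intro x hx
    rw [eval_translatePoly]
    exact hp _ (hS x hx))
  have h2 : ∀ ij, HasDerivAt (fun s : ℂ => entries (1 + s • (g * X * h)) ij)
      (entries (g * X * h) ij) 0 := by
    intro ij
    simpa [entries] using ((hasDerivAt_id (0 : ℂ)).mul_const ((g * X * h) ij.1 ij.2)).const_add
      ((1 : Matrix ι ι ℂ) ij.1 ij.2)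
  have h3 := hasDerivAt_eval h2 p
  simp only [zero_smul, add_zero] at h3
  refine h3.unique ?_
  simpa [mul_add, add_mul, hgh] using h1

/-- The left invariant vector field of a tangent vector preserves the ideal of a multiplicatively
closed set. -/
theorem eval_leftInvDeriv_eq_zero {S : Set (Matrix ι ι ℂ)} (hmul : ∀ x ∈ S, ∀ y ∈ S, x * y ∈ S)
    {X : Matrix ι ι ℂ} (hX : X ∈ tangentSpace S) {p : MvPolynomial (ι × ι) ℂ}
    (hp : ∀ g ∈ S, MvPolynomial.eval (entries g) p = 0) :
    ∀ g ∈ S, MvPolynomial.eval (entries g) (leftInvDeriv X p) = 0 := by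
  intro g hg
  have h1 := hasDerivAt_eval_of_mem_tangentSpace hX (p := translatePoly g 1 p) (by
    intro x hx
    rw [eval_translatePoly, mul_one]
    exact hp _ (hmul g hg x hx))
  have h2 : ∀ ij, HasDerivAt (fun s : ℂ => entries (g + s • (g * X)) ij)
      (entries (g * X) ij) 0 := by
    intro ij
    simpa [entries] using ((hasDerivAt_id (0 : ℂ)).mul_const ((g * X) ij.1 ij.2)).const_add
      (g ij.1 ij.2)
  have h3 := hasDerivAt_eval h2 p
  simp only [zero_smul, add_zero] at h3
  rw [eval_leftInvDeriv]
  refine h3.unique ?_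
  simpa [mul_add] using h1

theorem iteratedDeriv_eval_exp (A : Matrix ι ι ℂ) (n : ℕ) : ∀ p : MvPolynomial (ι × ι) ℂ,
    iteratedDeriv n (fun s : ℂ => MvPolynomial.eval (entries (NormedSpace.exp (s • A))) p) =
      fun s => MvPolynomial.eval (entries (NormedSpace.exp (s • A))) ((leftInvDeriv A)^[n] p) := by
  induction n with
  | zero => intro p; simp
  | succ n ih =>
    intro p
    rw [iteratedDeriv_succ', Function.iterate_succ_apply, ← ih]
    congr 1
    funext s
    exact (hasDerivAt_eval_exp A p s).deriv

/-- The exponential of a tangent vector lies in the Zariski closure: along `s ↦ exp (s • X)` every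
polynomial vanishing on `S` is an entire function all of whose Taylor coefficients are zero. -/
theorem eval_exp_eq_zero {S : Set (Matrix ι ι ℂ)} (h1 : (1 : Matrix ι ι ℂ) ∈ S)
    (hmul : ∀ x ∈ S, ∀ y ∈ S, x * y ∈ S)
    {X : Matrix ι ι ℂ} (hX : X ∈ tangentSpace S) {p : MvPolynomial (ι × ι) ℂ}
    (hp : ∀ g ∈ S, MvPolynomial.eval (entries g) p = 0) (s : ℂ) :
    MvPolynomial.eval (entries (NormedSpace.exp (s • X))) p = 0 := by
  have hn : ∀ n : ℕ, ∀ g ∈ S, MvPolynomial.eval (entries g) ((leftInvDeriv X)^[n] p) = 0 := by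
    intro n
    induction n with
    | zero => exact hp
    | succ n ih =>
      rw [Function.iterate_succ_apply']
      exact eval_leftInvDeriv_eq_zero hmul hX ih
  rw [← Complex.taylorSeries_eq_of_entire' 0 s (differentiable_eval_exp X p)]
  simp [iteratedDeriv_eval_exp, NormedSpace.exp_zero, hn _ 1 h1]

/-- A matrix `X` with `exp (s • X)` in the Zariski closure of `S` for all `s` is tangent to `S`. -/
theorem mem_tangentSpace_of_eval_exp {S : Set (Matrix ι ι ℂ)} {X : Matrix ι ι ℂ}
    (h : ∀ p : MvPolynomial (ι × ι) ℂ, (∀ g ∈ S, MvPolynomial.eval (entries g) p = 0) →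
      ∀ s : ℂ, MvPolynomial.eval (entries (NormedSpace.exp (s • X))) p = 0) :
    X ∈ tangentSpace S := by
  intro p hp
  have h1 := hasDerivAt_eval_exp X p 0
  rw [eval_leftInvDeriv] at h1
  simp only [zero_smul, NormedSpace.exp_zero, one_mul, h p hp] at h1
  exact h1.unique (hasDerivAt_const _ _)

theorem exp_smul_add (X : Matrix ι ι ℂ) (s t : ℂ) :
    NormedSpace.exp ((s + t) • X) = NormedSpace.exp (s • X) * NormedSpace.exp (t • X) := by
  rw [add_smul]
  exact Matrix.exp_add_of_commute _ _ (((Commute.refl X).smul_left s).smul_right t)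

theorem exp_smul_mul_exp_neg (X : Matrix ι ι ℂ) (s : ℂ) :
    NormedSpace.exp (s • X) * NormedSpace.exp ((-s) • X) = 1 := by
  rw [← exp_smul_add]; simp [NormedSpace.exp_zero]

/-- `X` is determined by its one-parameter group, along real parameters. -/
theorem eq_zero_of_exp_real_smul_eq_one {X : Matrix ι ι ℂ}
    (h : ∀ s : ℝ, NormedSpace.exp ((s : ℂ) • X) = 1) : X = 0 := by
  ext i j
  have h1 := (hasDerivAt_exp_entries X (0 : ℝ)) (i, j)
  have h2 : ∀ s : ℝ, NormedSpace.exp (s • X) = 1 := fun s => by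
    simpa using h s
  simp only [h2, one_mul] at h1
  exact h1.unique (hasDerivAt_const _ _)
end

noncomputable section
variable {ι : Type*} [Fintype ι] [DecidableEq ι]

/-! ### Exponential polynomials -/

theorem eq_zero_of_derivative_add_C_mul_eq_zero {c : ℂ} (hc : c ≠ 0) {r : Polynomial ℂ}
    (h : Polynomial.derivative r + Polynomial.C c * r = 0) : r = 0 := by
  by_contra hr
  have h1 := Polynomial.degree_derivative_lt hr
  rw [← Polynomial.degree_C_mul hc (p := r)] at h1
  rw [add_eq_zero_iff_eq_neg] at h
  rw [h, Polynomial.degree_neg] at h1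
  exact lt_irrefl _ h1

/-- Linear independence of the functions `s ↦ s ^ k * exp (ν * s)`. -/
theorem eq_zero_of_sum_eval_mul_exp_eq_zero (S : Finset ℂ) : ∀ (r : ℂ → Polynomial ℂ),
    (∀ s : ℂ, ∑ ν ∈ S, (r ν).eval s * Complex.exp (ν * s) = 0) → ∀ ν ∈ S, r ν = 0 := by
  induction S using Finset.induction_on with
  | empty => simp
  | insert a S ha ih =>
    suffices H : ∀ (n : ℕ) (r : ℂ → Polynomial ℂ), (r a).degree < n →
        (∀ s : ℂ, ∑ ν ∈ insert a S, (r ν).eval s * Complex.exp (ν * s) = 0) →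
        ∀ ν ∈ insert a S, r ν = 0 by
      intro r h
      refine H ((r a).natDegree + 1) r ?_ h
      exact Polynomial.degree_le_natDegree.trans_lt (by exact_mod_cast Nat.lt_succ_self _)
    intro n
    induction n with
    | zero =>
      intro r hr h
      have hra : r a = 0 := by
        by_contra h0
        rw [Polynomial.degree_eq_natDegree h0] at hr
        simp at hr
      intro ν hν
      rcases Finset.mem_insert.1 hν with rfl | hν
      · exact hra
      · refine ih r (fun s => ?_) ν hν
        have := h s
        rwa [Finset.sum_insert ha, hra, Polynomial.eval_zero, zero_mul, zero_add] at this
    | succ n ihn =>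
      intro r hr h
      -- `d/ds - a` lowers the degree of the coefficient of `exp (a * s)`
      -- and is injective on the coefficients of the other exponentials
      set r' : ℂ → Polynomial ℂ := fun ν =>
        Polynomial.derivative (r ν) + Polynomial.C (ν - a) * r ν with hr'
      have h1 : ∀ s : ℂ, ∑ ν ∈ insert a S, (r' ν).eval s * Complex.exp (ν * s) = 0 := by
        intro s
        have hd : HasDerivAt (fun s => ∑ ν ∈ insert a S, (r ν).eval s * Complex.exp (ν * s))
            (∑ ν ∈ insert a S, ((Polynomial.derivative (r ν)).eval s * Complex.exp (ν * s) +
              (r ν).eval s * (Complex.exp (ν * s) * ν))) s := by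
          refine HasDerivAt.fun_sum fun ν _ => ?_
          refine ((r ν).hasDerivAt s).mul ?_
          simpa using (((hasDerivAt_id s).const_mul ν).cexp)
        simp only [h] at hd
        have h2 := hd.unique (hasDerivAt_const _ _)
        have h3 := congrArg₂ (· - a * ·) h2 (h s)
        simp only [mul_zero, sub_zero, Finset.mul_sum, ← Finset.sum_sub_distrib] at h3
        rw [← h3]
        refine Finset.sum_congr rfl fun ν _ => ?_
        simp only [hr', Polynomial.eval_add, Polynomial.eval_mul, Polynomial.eval_C]
        ring
      have h2 : (r' a).degree < n := by
        simp only [hr', sub_self, map_zero, zero_mul, add_zero]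
        by_cases h0 : r a = 0
        · simp [h0]
        · refine lt_of_lt_of_le (Polynomial.degree_derivative_lt h0) ?_
          rw [Polynomial.degree_eq_natDegree h0] at hr ⊢
          exact_mod_cast Nat.lt_succ_iff.1 (by exact_mod_cast hr)
      have h3 := ihn r' h2 h1
      have h4 : ∀ ν ∈ S, r ν = 0 := fun ν hν =>
        eq_zero_of_derivative_add_C_mul_eq_zero (c := ν - a)
          (sub_ne_zero.2 fun e => ha (e ▸ hν)) (h3 ν (Finset.mem_insert_of_mem hν))
      intro ν hν
      rcases Finset.mem_insert.1 hν with rfl | hν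
      · refine Polynomial.funext fun s => ?_
        have := h s
        rw [Finset.sum_insert ha, Finset.sum_eq_zero fun ν hν => by rw [h4 ν hν]; simp,
          add_zero] at this
        simpa using (mul_eq_zero.1 this).resolve_right (Complex.exp_ne_zero _)
      · exact h4 ν hν

/-! ### Jordan decomposition and replicas -/

theorem exists_units_diagonal_add_isNilpotent (X : Matrix ι ι ℂ) :
    ∃ (U : (Matrix ι ι ℂ)ˣ) (μ : ι → ℂ) (N : Matrix ι ι ℂ),
      X = U.val * Matrix.diagonal μ * U⁻¹.val + N ∧ IsNilpotent N ∧
        Commute (U.val * Matrix.diagonal μ * U⁻¹.val) N := by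
  classical
  obtain ⟨n, hn, s, hs, hnil, hss, hX⟩ :=
    Module.End.exists_isNilpotent_isSemisimple (f := Matrix.toLin' X)
  have hspan : (⊤ : Submodule ℂ (ι → ℂ)) ≤
      Submodule.span ℂ {v | ∃ μ : ℂ, s v = μ • v} := by
    rw [← hss.iSup_eigenspace_eq_top]
    refine iSup_le fun μ v hv => Submodule.subset_span ⟨μ, ?_⟩
    exact Module.End.mem_eigenspace_iff.1 hv
  let b₀ := Module.Basis.ofSpan hspan
  have := Module.Finite.finite_basis b₀
  have := Fintype.ofFinite ↑(LinearIndepOn.extend (linearIndepOn_empty ℂ id)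
    (Set.empty_subset {v : ι → ℂ | ∃ μ : ℂ, s v = μ • v}))
  have e := (b₀.indexEquiv (Pi.basisFun ℂ ι))
  let b := b₀.reindex e
  have hb : ∀ i, ∃ μ : ℂ, s (b i) = μ • b i := by
    intro i
    rw [Module.Basis.reindex_apply]
    exact Module.Basis.ofSpan_subset hspan (Set.mem_range_self (e.symm i))
  choose μ hμ using hb
  let U : (Matrix ι ι ℂ)ˣ := ⟨(Pi.basisFun ℂ ι).toMatrix b, b.toMatrix (Pi.basisFun ℂ ι),
    by simp, by simp⟩
  have hU : LinearMap.toMatrix' s * U.val = U.val * Matrix.diagonal μ := by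
    ext i j
    have h1 := congrFun (hμ j) i
    rw [← Matrix.toLin'_toMatrix' s, Matrix.toLin'_apply] at h1
    simpa [U, Matrix.mul_apply, Module.Basis.toMatrix_apply, Matrix.mulVec, dotProduct,
      Matrix.diagonal_apply, mul_comm] using h1
  have hS : LinearMap.toMatrix' s = U.val * Matrix.diagonal μ * U⁻¹.val := by
    rw [← hU, mul_assoc, Units.mul_inv, mul_one]
  refine ⟨U, μ, LinearMap.toMatrix' n, ?_, ?_, ?_⟩
  · rw [← hS, ← map_add, add_comm, ← hX, LinearMap.toMatrix'_toLin']
  · exact hnil.map (LinearMap.toMatrixAlgEquiv' (R := ℂ) (n := ι))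
  · rw [← hS]
    have : Commute s n := (Algebra.commute_of_mem_adjoin_singleton_of_commute hs
      (Algebra.commute_of_mem_adjoin_singleton_of_commute hn (Commute.refl _)).symm).symm
    exact this.map (LinearMap.toMatrixAlgEquiv' (R := ℂ) (n := ι))

/-- The entries of `exp (s • N)` for nilpotent `N` are polynomials in `s`. -/
theorem exists_polynomial_exp_of_isNilpotent {N : Matrix ι ι ℂ} (hN : IsNilpotent N) :
    ∃ E : Matrix ι ι (Polynomial ℂ), ∀ s : ℂ,
      NormedSpace.exp (s • N) = E.map (Polynomial.eval s) := by
  obtain ⟨m, hm⟩ := hN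
  refine ⟨∑ l ∈ Finset.range m, Matrix.of fun i j =>
    Polynomial.C ((l.factorial : ℂ)⁻¹ * (N ^ l) i j) * Polynomial.X ^ l, fun s => ?_⟩
  rw [NormedSpace.exp_eq_tsum ℂ]
  simp only
  rw [tsum_eq_sum (s := Finset.range m)]
  · ext i j
    simp only [Matrix.sum_apply, Matrix.map_apply, Polynomial.eval_finsetSum, Matrix.of_apply,
      smul_pow, Matrix.smul_apply, smul_eq_mul]
    refine Finset.sum_congr rfl fun l _ => ?_
    simp only [Polynomial.eval_mul, Polynomial.eval_C, Polynomial.eval_pow, Polynomial.eval_X]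
    ring
  · intro l hl
    rw [smul_pow, pow_eq_zero_of_le (by simpa using hl) hm, smul_zero, smul_zero]

theorem exp_units_conj_diagonal (U : (Matrix ι ι ℂ)ˣ) (μ : ι → ℂ) (s : ℂ) :
    NormedSpace.exp (s • (U.val * Matrix.diagonal μ * U⁻¹.val)) =
      U.val * Matrix.diagonal (fun i => Complex.exp (s * μ i)) * U⁻¹.val := by
  have : s • (U.val * Matrix.diagonal μ * U⁻¹.val) =
      U.val * Matrix.diagonal (s • μ) * U⁻¹.val := by
    rw [Matrix.diagonal_smul]; simp
  rw [this, Matrix.exp_units_conj, Matrix.exp_diagonal]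
  congr 3
  ext i
  rw [Pi.coe_exp, Complex.exp_eq_exp_ℂ]
  simp

/-- **Replicas.** If a polynomial vanishes on the one-parameter group of `X`, with semisimple part
of eigenvalues `μ i`, then it also vanishes on the one-parameter group of the matrix with the same
eigenvectors and the eigenvalues `f (μ i)`, for any additive `f`: along these groups the polynomial
is an exponential polynomial, and `f` respects the additive relations between its exponents. -/
theorem eval_exp_replica_eq_zero (U : (Matrix ι ι ℂ)ˣ) (μ : ι → ℂ) {N : Matrix ι ι ℂ}
    (hN : IsNilpotent N) (hc : Commute (U.val * Matrix.diagonal μ * U⁻¹.val) N) (f : ℂ →+ ℂ)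
    {p : MvPolynomial (ι × ι) ℂ}
    (hp : ∀ s : ℂ, MvPolynomial.eval (entries (NormedSpace.exp
      (s • (U.val * Matrix.diagonal μ * U⁻¹.val + N)))) p = 0) (s : ℂ) :
    MvPolynomial.eval (entries (NormedSpace.exp
      (s • (U.val * Matrix.diagonal (f ∘ μ) * U⁻¹.val)))) p = 0 := by
  classical
  obtain ⟨E, hE⟩ := exists_polynomial_exp_of_isNilpotent hN
  -- `q` has coefficients polynomial in `u`; its value at `z` is `p (U * diagonal z * U⁻¹ * exp (u • N))`
  set F : Matrix ι ι (Polynomial ℂ) := (U⁻¹.val.map Polynomial.C) * E with hF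
  set q : MvPolynomial ι (Polynomial ℂ) :=
    MvPolynomial.eval₂ (MvPolynomial.C.comp Polynomial.C) (fun ij : ι × ι =>
      ∑ k, MvPolynomial.C (Polynomial.C (U.val ij.1 k) * F k ij.2) * MvPolynomial.X k) p with hq
  have hqe : ∀ (u : ℂ) (z : ι → ℂ), MvPolynomial.eval₂ (Polynomial.evalRingHom u) z q =
      MvPolynomial.eval (entries (U.val * Matrix.diagonal z * U⁻¹.val *
        NormedSpace.exp (u • N))) p := by
    intro u z
    rw [hq, ← MvPolynomial.coe_eval₂Hom (Polynomial.evalRingHom u),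
      MvPolynomial.eval₂_comp_left (MvPolynomial.eval₂Hom (Polynomial.evalRingHom u) z)]
    have h1 : (MvPolynomial.eval₂Hom (Polynomial.evalRingHom u) z).comp
        (MvPolynomial.C.comp Polynomial.C) = RingHom.id ℂ := by ext; simp
    have h2 : F.map (Polynomial.eval u) = U⁻¹.val * NormedSpace.exp (u • N) := by
      rw [hE, hF, ← Polynomial.coe_evalRingHom, ← RingHom.mapMatrix_apply, map_mul]
      congr 1
      ext; simp
    rw [h1, mul_assoc (U.val * _), ← h2]
    refine congrArg (fun c => MvPolynomial.eval₂ (RingHom.id ℂ) c p) ?_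
    ext ij
    simp only [Function.comp_apply, map_sum, map_mul, entries, Matrix.mul_apply,
      Matrix.map_apply]
    refine Finset.sum_congr rfl fun k _ => ?_
    simp [Matrix.diagonal_apply]
    ring
  set w : (ι →₀ ℕ) → ℂ := fun a => ∑ i, (a i : ℂ) * μ i with hw
  have hprod : ∀ (g : ℂ →+ ℂ) (s : ℂ) (a : ι →₀ ℕ),
      ∏ i, Complex.exp (s * g (μ i)) ^ a i = Complex.exp (g (w a) * s) := by
    intro g s a
    rw [hw, map_sum, Finset.sum_mul, Complex.exp_sum]
    refine Finset.prod_congr rfl fun i _ => ?_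
    rw [← Complex.exp_nat_mul, ← nsmul_eq_mul (a i) (μ i), map_nsmul, nsmul_eq_mul]
    congr 1
    ring
  have hval : ∀ (g : ℂ →+ ℂ) (s u : ℂ), MvPolynomial.eval₂ (Polynomial.evalRingHom u)
      (fun i => Complex.exp (s * g (μ i))) q = ∑ ν ∈ q.support.image w,
        (∑ a ∈ q.support with w a = ν, MvPolynomial.coeff a q).eval u * Complex.exp (g ν * s) := by
    intro g s u
    rw [MvPolynomial.eval₂_eq', ← Finset.sum_fiberwise_of_maps_to
      (fun a ha => Finset.mem_image_of_mem w ha)]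
    refine Finset.sum_congr rfl fun ν _ => ?_
    rw [Polynomial.eval_finsetSum, Finset.sum_mul]
    refine Finset.sum_congr rfl fun a ha => ?_
    rw [hprod, (Finset.mem_filter.1 ha).2]
    rfl
  have hzero := eq_zero_of_sum_eval_mul_exp_eq_zero (q.support.image w)
    (fun ν => ∑ a ∈ q.support with w a = ν, MvPolynomial.coeff a q) (by
      intro s
      have h1 := hval (AddMonoidHom.id ℂ) s s
      simp only [AddMonoidHom.id_apply] at h1
      rw [← h1, hqe, ← exp_units_conj_diagonal, ← Matrix.exp_add_of_commute _ _
        ((hc.smul_left s).smul_right s), ← smul_add]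
      exact hp s)
  have h2 := hqe 0 (fun i => Complex.exp (s * f (μ i)))
  rw [hval f, zero_smul, NormedSpace.exp_zero, mul_one] at h2
  rw [exp_units_conj_diagonal]
  simp only [Function.comp_apply]
  rw [← h2]
  refine Finset.sum_eq_zero fun ν hν => ?_
  rw [hzero ν hν, Polynomial.eval_zero, zero_mul]
end

noncomputable section

/-! ### Zariski closures of one-parameter subgroups -/

section Closure
variable {n : ℕ}

theorem aeval_eq_eval_entries (k : Type) [Field k] [Algebra k ℂ] {ι : Type*} (x : Matrix ι ι ℂ)
    (p : MvPolynomial (ι × ι) k) :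
    MvPolynomial.aeval (fun ij : ι × ι => x ij.1 ij.2) p =
      MvPolynomial.eval (entries x) (MvPolynomial.map (algebraMap k ℂ) p) := by
  rw [MvPolynomial.eval_map, MvPolynomial.aeval_def]
  rfl

theorem IsZariskiClosed.exists_eval {k : Type} [Field k] [Algebra k ℂ] {S : Set (GL (Fin n) ℂ)}
    (hS : IsZariskiClosed k S) : ∃ I : Set (MvPolynomial (Fin n × Fin n) ℂ),
      ∀ g, g ∈ S ↔ ∀ p ∈ I, MvPolynomial.eval (entries g.val) p = 0 := by
  obtain ⟨I, rfl⟩ := hS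
  refine ⟨MvPolynomial.map (algebraMap k ℂ) '' I, fun g => ?_⟩
  simp only [aeval_eq_eval_entries, Set.mem_ofPred_eq, Set.forall_mem_image]

/-- The entries of `g⁻¹` are polynomials in those of `g`, up to a power of the determinant. -/
theorem exists_eval_inv (p : MvPolynomial (Fin n × Fin n) ℂ) :
    ∃ (q : MvPolynomial (Fin n × Fin n) ℂ) (m : ℕ), ∀ g : GL (Fin n) ℂ,
      g.val.det ^ m * MvPolynomial.eval (entries g⁻¹.val) p =
        MvPolynomial.eval (entries g.val) q := by
  let M : Matrix (Fin n) (Fin n) (MvPolynomial (Fin n × Fin n) ℂ) :=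
    Matrix.of fun i j => MvPolynomial.X (i, j)
  have hM : ∀ g : GL (Fin n) ℂ, (MvPolynomial.eval (entries g.val)).mapMatrix M = g.val := by
    intro g
    ext i j
    simp [M, entries]
  have hdet : ∀ g : GL (Fin n) ℂ, MvPolynomial.eval (entries g.val) M.det = g.val.det := by
    intro g
    rw [RingHom.map_det, hM]
  induction p using MvPolynomial.induction_on with
  | C a => exact ⟨MvPolynomial.C a, 0, fun g => by simp⟩
  | add p₁ p₂ h₁ h₂ =>
    obtain ⟨q₁, m₁, h₁⟩ := h₁
    obtain ⟨q₂, m₂, h₂⟩ := h₂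
    refine ⟨M.det ^ m₂ * q₁ + M.det ^ m₁ * q₂, m₁ + m₂, fun g => ?_⟩
    rw [map_add, map_add, map_mul, map_mul, map_pow, map_pow, hdet, ← h₁, ← h₂]
    ring
  | mul_X p ij h =>
    obtain ⟨q, m, h⟩ := h
    refine ⟨q * M.adjugate ij.1 ij.2, m + 1, fun g => ?_⟩
    have hadj : MvPolynomial.eval (entries g.val) (M.adjugate ij.1 ij.2) =
        g.val.det * entries g⁻¹.val ij := by
      have h1 : (MvPolynomial.eval (entries g.val)).mapMatrix M.adjugate = g.val.adjugate := by
        rw [RingHom.map_adjugate, hM]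
      have h2 : g.val.adjugate = g.val.det • g⁻¹.val := by
        have := congrArg (· * g⁻¹.val) (Matrix.adjugate_mul g.val)
        simpa [mul_assoc] using this
      have h3 := congrFun (congrFun (h1.trans h2) ij.1) ij.2
      simpa [entries] using h3
    rw [map_mul, map_mul, hadj, ← h, MvPolynomial.eval_X]
    ring

/-- `exp (s • Z)` as an invertible matrix. -/
def expUnit (Z : Matrix (Fin n) (Fin n) ℂ) (s : ℂ) : GL (Fin n) ℂ :=
  ⟨NormedSpace.exp (s • Z), NormedSpace.exp ((-s) • Z), exp_smul_mul_exp_neg Z s, by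
    simpa using exp_smul_mul_exp_neg Z (-s)⟩

theorem expUnit_inv (Z : Matrix (Fin n) (Fin n) ℂ) (s : ℂ) :
    (expUnit Z s)⁻¹ = expUnit Z (-s) := by
  ext : 1
  rfl

/-- The Zariski closure of the one-parameter group `s ↦ exp (s • Z)` in `GL_n(ℂ)`. -/
def expClosure (Z : Matrix (Fin n) (Fin n) ℂ) : Subgroup (GL (Fin n) ℂ) where
  carrier := {g | ∀ p, (∀ s, MvPolynomial.eval (entries (expUnit Z s).val) p = 0) →
    MvPolynomial.eval (entries g.val) p = 0}
  one_mem' p hp := by simpa [expUnit, NormedSpace.exp_zero] using hp 0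
  mul_mem' {g h} hg hh p hp := by
    have h1 : ∀ s, MvPolynomial.eval (entries ((expUnit Z s).val * h.val)) p = 0 := by
      intro s
      have := hh (translatePoly (expUnit Z s).val 1 p) (fun t => by
        rw [eval_translatePoly, mul_one]
        have := hp (s + t)
        rwa [expUnit, Units.val_mk, exp_smul_add] at this)
      rwa [eval_translatePoly, mul_one] at this
    have := hg (translatePoly 1 h.val p) (fun t => by
      rw [eval_translatePoly, one_mul]
      exact h1 t)
    rwa [eval_translatePoly, one_mul] at this
  inv_mem' {g} hg p hp := by
    obtain ⟨q, m, hq⟩ := exists_eval_inv p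
    have h1 := hg q (fun s => by rw [← hq, expUnit_inv, hp, mul_zero])
    rw [← hq] at h1
    exact (mul_eq_zero.1 h1).resolve_left (pow_ne_zero _ (Matrix.isUnits_det_units g).ne_zero)

theorem expUnit_mem_expClosure (Z : Matrix (Fin n) (Fin n) ℂ) (s : ℂ) :
    expUnit Z s ∈ expClosure Z := fun _ hp => hp s

theorem isZariskiClosed_expClosure (Z : Matrix (Fin n) (Fin n) ℂ) :
    IsZariskiClosed ℂ (expClosure Z : Set (GL (Fin n) ℂ)) := by
  refine ⟨{p | ∀ s, MvPolynomial.eval (entries (expUnit Z s).val) p = 0}, ?_⟩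
  ext g
  simp only [aeval_eq_eval_entries, Algebra.algebraMap_self, MvPolynomial.map_id]
  rfl

theorem expClosure_subset {k : Type} [Field k] [Algebra k ℂ] {Z : Matrix (Fin n) (Fin n) ℂ}
    {A : Set (GL (Fin n) ℂ)} (hA : IsZariskiClosed k A) (h : ∀ s, expUnit Z s ∈ A) :
    (expClosure Z : Set (GL (Fin n) ℂ)) ⊆ A := by
  obtain ⟨I, hI⟩ := hA.exists_eval
  exact fun g hg => (hI g).2 fun p hp => hg p fun s => (hI _).1 (h s) p hp

theorem entire_eq_zero_or_eq_zero {f g : ℂ → ℂ} (hf : Differentiable ℂ f)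
    (hg : Differentiable ℂ g) (h : ∀ z, f z * g z = 0) : (∀ z, f z = 0) ∨ ∀ z, g z = 0 := by
  have hf' : AnalyticOnNhd ℂ f Set.univ := fun z _ => hf.analyticAt z
  have hg' : AnalyticOnNhd ℂ g Set.univ := fun z _ => hg.analyticAt z
  rcases hf'.eq_zero_or_eq_zero_of_mul_eq_zero hg' (fun z _ => h z) isPreconnected_univ with h | h
  · exact Or.inl fun z => h z trivial
  · exact Or.inr fun z => h z trivial

/-- The closure of a one-parameter group is irreducible, because entire functions have no zero
divisors, and hence connected. -/
theorem isZariskiConnected_expClosure (Z : Matrix (Fin n) (Fin n) ℂ) :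
    IsZariskiConnected (expClosure Z : Set (GL (Fin n) ℂ)) := by
  refine ⟨⟨1, one_mem _⟩, fun A B hA hB hAB _ => ?_⟩
  by_contra! hcon
  have key : ∀ C : Set (GL (Fin n) ℂ), IsZariskiClosed ℂ C →
      ¬ (expClosure Z : Set (GL (Fin n) ℂ)) ⊆ C →
      ∃ p, (∀ g ∈ C, MvPolynomial.eval (entries g.val) p = 0) ∧
        ∃ s, MvPolynomial.eval (entries (expUnit Z s).val) p ≠ 0 := by
    intro C hC hn
    have : ∃ s, expUnit Z s ∉ C := by
      by_contra! h
      exact hn (expClosure_subset hC h)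
    obtain ⟨s, hs⟩ := this
    obtain ⟨I, hI⟩ := hC.exists_eval
    simp only [hI, not_forall] at hs
    obtain ⟨p, hp, hps⟩ := hs
    exact ⟨p, fun g hg => (hI g).1 hg p hp, s, hps⟩
  obtain ⟨p, hpA, s, hs⟩ := key A hA hcon.1
  obtain ⟨q, hqB, t, ht⟩ := key B hB hcon.2
  have hpq : ∀ u : ℂ, MvPolynomial.eval (entries (NormedSpace.exp (u • Z))) p *
      MvPolynomial.eval (entries (NormedSpace.exp (u • Z))) q = 0 := by
    intro u
    rcases hAB (expUnit_mem_expClosure Z u) with h | h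
    · have h1 : MvPolynomial.eval (entries (NormedSpace.exp (u • Z))) p = 0 := hpA (expUnit Z u) h
      rw [h1, zero_mul]
    · have h1 : MvPolynomial.eval (entries (NormedSpace.exp (u • Z))) q = 0 := hqB (expUnit Z u) h
      rw [h1, mul_zero]
  rcases entire_eq_zero_or_eq_zero (differentiable_eval_exp Z p) (differentiable_eval_exp Z q) hpq
    with h | h
  · exact hs (h s)
  · exact ht (h t)

/-- A connected semisimple group contains no central one-parameter group. -/
theorem IsConnectedSemisimpleQ.eq_zero_of_exp_central {G : Subgroup (GL (Fin n) ℂ)}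
    (hG : IsConnectedSemisimpleQ G) {Z : Matrix (Fin n) (Fin n) ℂ} (hZ : ∀ s, expUnit Z s ∈ G)
    (hcomm : ∀ g ∈ G, Commute g.val Z) : Z = 0 := by
  have hle : expClosure Z ≤ G := expClosure_subset hG.closed hZ
  have hcent : ∀ g ∈ G, ∀ x ∈ expClosure Z, g * x = x * g := by
    intro g hg x hx
    have h1 : ∀ ij : Fin n × Fin n, entries (g.val * x.val) ij = entries (x.val * g.val) ij := by
      intro ij
      have h := hx (translatePoly g.val 1 (MvPolynomial.X ij) -
        translatePoly 1 g.val (MvPolynomial.X ij)) (fun s => by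
          rw [map_sub, eval_translatePoly, eval_translatePoly, one_mul, mul_one,
            expUnit, Units.val_mk]
          have : Commute g.val (NormedSpace.exp (s • Z)) := by
            open scoped Matrix.Norms.Operator in
            exact ((hcomm g hg).smul_right s).exp_right
          rw [this.eq, sub_self])
      simpa [sub_eq_zero] using h
    ext i j
    exact h1 (i, j)
  have hbot : expClosure Z = ⊥ := by
    refine hG.radical _ ⟨hle, ?_⟩ (isZariskiClosed_expClosure Z)
      (isZariskiConnected_expClosure Z) ?_
    · intro h hh x hx
      rwa [hcent h hh x hx, mul_inv_cancel_right]
    · refine Group.isSolvable_of_comm fun a b => ?_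
      ext1
      exact hcent _ (hle a.2) _ b.2
  refine eq_zero_of_exp_real_smul_eq_one fun s => ?_
  have : expUnit Z s ∈ expClosure Z := expUnit_mem_expClosure Z s
  rw [hbot, Subgroup.mem_bot] at this
  exact congrArg Units.val this

end Closure
end

noncomputable section

/-! ### The graph of a representation and its Lie algebra -/

section Graph
variable {n d : ℕ} {G : Subgroup (GL (Fin n) ℂ)}

/-- The graph of `ρ`, embedded in `GL_{n+d}` by block diagonal matrices. Its tangent space at the
identity is the Lie algebra of `G` together with the derivative of `ρ`. -/
def graphSet (ρ : G →* GL (Fin d) ℂ) : Set (Matrix (Fin n ⊕ Fin d) (Fin n ⊕ Fin d) ℂ) :=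
  Set.range fun g : G => Matrix.fromBlocks (g : GL (Fin n) ℂ).val 0 0 (ρ g).val

theorem one_mem_graphSet (ρ : G →* GL (Fin d) ℂ) : 1 ∈ graphSet ρ :=
  ⟨1, by simp⟩

theorem mul_mem_graphSet (ρ : G →* GL (Fin d) ℂ) :
    ∀ x ∈ graphSet ρ, ∀ y ∈ graphSet ρ, x * y ∈ graphSet ρ := by
  rintro _ ⟨g, rfl⟩ _ ⟨h, rfl⟩
  exact ⟨g * h, by simp [Matrix.fromBlocks_multiply]⟩

open scoped Matrix.Norms.Operator in
theorem exp_fromBlocks_diagonal {m l : Type*} [Fintype m] [DecidableEq m] [Fintype l]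
    [DecidableEq l] (A : Matrix m m ℂ) (B : Matrix l l ℂ) :
    NormedSpace.exp (Matrix.fromBlocks A 0 0 B) =
      Matrix.fromBlocks (NormedSpace.exp A) 0 0 (NormedSpace.exp B) := by
  let φ : Matrix m m ℂ × Matrix l l ℂ →+* Matrix (m ⊕ l) (m ⊕ l) ℂ :=
    { toFun := fun x => Matrix.fromBlocks x.1 0 0 x.2
      map_one' := by simp
      map_mul' := fun x y => by simp [Matrix.fromBlocks_multiply]
      map_zero' := by simp
      map_add' := fun x y => by simp [Matrix.fromBlocks_add] }
  have hφ : Continuous φ :=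
    Continuous.matrix_fromBlocks continuous_fst continuous_const continuous_const continuous_snd
  have h := NormedSpace.map_exp φ hφ (A, B)
  have h1 : NormedSpace.exp (A, B) = (NormedSpace.exp A, NormedSpace.exp B) :=
    Prod.ext (Prod.fst_exp _) (Prod.snd_exp _)
  exact h.symm.trans (congrArg φ h1)

theorem entries_eq_zero_of_mem_tangentSpace {ι : Type*} [Fintype ι] [DecidableEq ι]
    {S : Set (Matrix ι ι ℂ)} {X : Matrix ι ι ℂ} (hX : X ∈ tangentSpace S) {i j : ι}
    (h : ∀ g ∈ S, g i j = 0) : X i j = 0 := by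
  have := hX (MvPolynomial.X (i, j)) (by simpa [entries] using h)
  simpa [MvPolynomial.pderiv_X, Pi.single_apply, entries, apply_ite] using this

theorem eq_fromBlocks_of_mem_tangentSpace {ρ : G →* GL (Fin d) ℂ}
    {X : Matrix (Fin n ⊕ Fin d) (Fin n ⊕ Fin d) ℂ} (hX : X ∈ tangentSpace (graphSet ρ)) :
    X = Matrix.fromBlocks X.toBlocks₁₁ 0 0 X.toBlocks₂₂ := by
  conv_lhs => rw [← Matrix.fromBlocks_toBlocks X]
  congr 1
  · ext i j
    exact entries_eq_zero_of_mem_tangentSpace hX (by rintro _ ⟨g, rfl⟩; simp)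
  · ext i j
    exact entries_eq_zero_of_mem_tangentSpace hX (by rintro _ ⟨g, rfl⟩; simp)

/-- `exp` maps the Lie algebra of the graph to the graph. -/
theorem exists_expUnit_of_mem_tangentSpace (hG : IsZariskiClosed ℚ (G : Set (GL (Fin n) ℂ)))
    {ρ : G →* GL (Fin d) ℂ} (hρ : IsRationalQ ρ)
    {X : Matrix (Fin n ⊕ Fin d) (Fin n ⊕ Fin d) ℂ} (hX : X ∈ tangentSpace (graphSet ρ)) (s : ℂ) :
    ∃ h : expUnit X.toBlocks₁₁ s ∈ G,
      (ρ ⟨expUnit X.toBlocks₁₁ s, h⟩).val = NormedSpace.exp (s • X.toBlocks₂₂) := by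
  have hexp : NormedSpace.exp (s • X) = Matrix.fromBlocks (expUnit X.toBlocks₁₁ s).val 0 0
      (NormedSpace.exp (s • X.toBlocks₂₂)) := by
    conv_lhs => rw [eq_fromBlocks_of_mem_tangentSpace hX, Matrix.fromBlocks_smul, smul_zero,
      smul_zero, exp_fromBlocks_diagonal]
    rfl
  have hvan : ∀ p : MvPolynomial ((Fin n ⊕ Fin d) × (Fin n ⊕ Fin d)) ℂ,
      (∀ g ∈ graphSet ρ, MvPolynomial.eval (entries g) p = 0) →
      MvPolynomial.eval (entries (Matrix.fromBlocks (expUnit X.toBlocks₁₁ s).val 0 0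
      (NormedSpace.exp (s • X.toBlocks₂₂)))) p = 0 := fun p hp => by
    rw [← hexp]
    exact eval_exp_eq_zero (one_mem_graphSet ρ) (mul_mem_graphSet ρ) hX hp s
  let ι₁ : Fin n × Fin n → (Fin n ⊕ Fin d) × (Fin n ⊕ Fin d) := fun ij => (.inl ij.1, .inl ij.2)
  have hren : ∀ (A : Matrix (Fin n) (Fin n) ℂ) (B : Matrix (Fin d) (Fin d) ℂ)
      (p : MvPolynomial (Fin n × Fin n) ℂ),
      MvPolynomial.eval (entries (Matrix.fromBlocks A 0 0 B)) (MvPolynomial.rename ι₁ p) =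
        MvPolynomial.eval (entries A) p := by
    intro A B p
    rw [MvPolynomial.eval_rename]
    rfl
  have hmem : expUnit X.toBlocks₁₁ s ∈ G := by
    obtain ⟨I, hGI⟩ := hG.exists_eval
    refine (hGI _).2 fun p hp => ?_
    rw [← hren _ (NormedSpace.exp (s • X.toBlocks₂₂))]
    refine hvan _ ?_
    rintro _ ⟨g, rfl⟩
    rw [hren]
    exact (hGI g).1 g.2 p hp
  refine ⟨hmem, ?_⟩
  ext i j
  obtain ⟨p, m, hp⟩ := hρ i j
  -- the polynomial equation `det g ^ m * ρ(g)_ij = p(g)` holds on the graph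
  let M : Matrix (Fin n) (Fin n) (MvPolynomial (Fin n × Fin n) ℂ) :=
    Matrix.of fun i j => MvPolynomial.X (i, j)
  have hdet : ∀ A : Matrix (Fin n) (Fin n) ℂ, MvPolynomial.eval (entries A) M.det = A.det := by
    intro A
    rw [RingHom.map_det]
    congr 1
    ext i j
    simp [M, entries]
  let Q : MvPolynomial ((Fin n ⊕ Fin d) × (Fin n ⊕ Fin d)) ℂ :=
    MvPolynomial.rename ι₁ (M.det ^ m) * MvPolynomial.X (.inr i, .inr j) -
      MvPolynomial.rename ι₁ (MvPolynomial.map (algebraMap ℚ ℂ) p)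
  have hQ : ∀ (A : Matrix (Fin n) (Fin n) ℂ) (B : Matrix (Fin d) (Fin d) ℂ),
      MvPolynomial.eval (entries (Matrix.fromBlocks A 0 0 B)) Q = A.det ^ m * B i j -
        MvPolynomial.eval (entries A) (MvPolynomial.map (algebraMap ℚ ℂ) p) := by
    intro A B
    rw [map_sub, map_mul, hren, hren, map_pow, hdet, MvPolynomial.eval_X]
    rfl
  have hρQ : ∀ g : G, (g : GL (Fin n) ℂ).val.det ^ m * (ρ g).val i j =
      MvPolynomial.eval (entries (g : GL (Fin n) ℂ).val) (MvPolynomial.map (algebraMap ℚ ℂ) p) := by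
    intro g
    have h0 : (g : GL (Fin n) ℂ).val.det ≠ 0 := (Matrix.isUnits_det_units _).ne_zero
    rw [hp g, aeval_eq_eval_entries]
    rw [mul_left_comm, ← mul_pow, mul_inv_cancel₀ h0, one_pow, mul_one]
  have h1 := hvan Q (by
    rintro _ ⟨g, rfl⟩
    rw [hQ, hρQ, sub_self])
  rw [hQ, sub_eq_zero, ← hρQ ⟨_, hmem⟩] at h1
  exact mul_left_cancel₀ (pow_ne_zero _ (Matrix.isUnits_det_units _).ne_zero) h1.symm

theorem conj_mem_tangentSpace_graphSet {ρ : G →* GL (Fin d) ℂ}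
    {X : Matrix (Fin n ⊕ Fin d) (Fin n ⊕ Fin d) ℂ} (hX : X ∈ tangentSpace (graphSet ρ)) (g : G) :
    Matrix.fromBlocks (g : GL (Fin n) ℂ).val 0 0 (ρ g).val * X *
      Matrix.fromBlocks (g : GL (Fin n) ℂ)⁻¹.val 0 0 (ρ g)⁻¹.val ∈ tangentSpace (graphSet ρ) := by
  refine conj_mem_tangentSpace hX (by simp [Matrix.fromBlocks_multiply]) ?_
  intro x hx
  refine mul_mem_graphSet ρ _ (mul_mem_graphSet ρ _ ⟨g, rfl⟩ _ hx) _ ⟨g⁻¹, by simp⟩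

theorem toBlocks₂₂_conj {ρ : G →* GL (Fin d) ℂ}
    {X : Matrix (Fin n ⊕ Fin d) (Fin n ⊕ Fin d) ℂ} (hX : X ∈ tangentSpace (graphSet ρ)) (g : G) :
    (Matrix.fromBlocks (g : GL (Fin n) ℂ).val 0 0 (ρ g).val * X *
      Matrix.fromBlocks (g : GL (Fin n) ℂ)⁻¹.val 0 0 (ρ g)⁻¹.val).toBlocks₂₂ =
      (ρ g).val * X.toBlocks₂₂ * (ρ g)⁻¹.val := by
  conv_lhs => rw [eq_fromBlocks_of_mem_tangentSpace hX]
  simp [Matrix.fromBlocks_multiply]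

open scoped Matrix.Norms.Operator in
theorem mem_of_hasDerivAt {ι : Type*} [Fintype ι] [DecidableEq ι]
    (W : Submodule ℂ (Matrix ι ι ℂ)) {c : ℂ → Matrix ι ι ℂ} {X : Matrix ι ι ℂ} (hc : ∀ s, c s ∈ W)
    (h : HasDerivAt c X 0) : X ∈ W := by
  have h1 := h.tendsto_slope
  refine (Submodule.closed_of_finiteDimensional W).mem_of_tendsto h1 (Eventually.of_forall fun s => ?_)
  rw [slope_def_module]
  exact W.smul_mem _ (W.sub_mem (hc _) (hc _))

open scoped Matrix.Norms.Operator in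
/-- The Lie algebra of the graph is closed under commutators. -/
theorem commutator_mem_tangentSpace_graphSet (hG : IsZariskiClosed ℚ (G : Set (GL (Fin n) ℂ)))
    {ρ : G →* GL (Fin d) ℂ} (hρ : IsRationalQ ρ)
    {X Y : Matrix (Fin n ⊕ Fin d) (Fin n ⊕ Fin d) ℂ} (hX : X ∈ tangentSpace (graphSet ρ))
    (hY : Y ∈ tangentSpace (graphSet ρ)) : X * Y - Y * X ∈ tangentSpace (graphSet ρ) := by
  have hc : ∀ s : ℂ, NormedSpace.exp (s • X) * Y * NormedSpace.exp (s • -X) ∈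
      tangentSpace (graphSet ρ) := by
    intro s
    have hmem : ∀ s : ℂ, NormedSpace.exp (s • X) ∈ graphSet ρ := by
      intro s
      obtain ⟨h1, h2⟩ := exists_expUnit_of_mem_tangentSpace hG hρ hX s
      refine ⟨⟨_, h1⟩, ?_⟩
      conv_rhs => rw [eq_fromBlocks_of_mem_tangentSpace hX, Matrix.fromBlocks_smul, smul_zero,
        smul_zero, exp_fromBlocks_diagonal]
      simp only [h2]
      rfl
    rw [smul_neg, ← neg_smul]
    refine conj_mem_tangentSpace hY (exp_smul_mul_exp_neg X s) fun x hx => ?_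
    exact mul_mem_graphSet ρ _ (mul_mem_graphSet ρ _ (hmem s) _ hx) _ (hmem (-s))
  refine mem_of_hasDerivAt _ hc ?_
  have h := ((hasDerivAt_exp_smul_const X (0 : ℂ)).mul_const Y).mul
    (hasDerivAt_exp_smul_const (-X) (0 : ℂ))
  refine h.congr_deriv ?_
  simp [NormedSpace.exp_zero, sub_eq_add_neg]

end Graph
end

noncomputable section

/-! ### The trace form and central elements -/

section TraceForm
variable {n d : ℕ} {G : Subgroup (GL (Fin n) ℂ)}

theorem commute_diagonal_comp {ι : Type*} [Fintype ι] [DecidableEq ι] {μ : ι → ℂ}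
    {N : Matrix ι ι ℂ} (h : Commute (Matrix.diagonal μ) N) (f : ℂ → ℂ) :
    Commute (Matrix.diagonal (f ∘ μ)) N := by
  ext i j
  have h1 := congrFun (congrFun h.eq i) j
  simp only [Matrix.diagonal_mul, Matrix.mul_diagonal, Function.comp_apply] at h1 ⊢
  by_cases h0 : N i j = 0
  · simp [h0]
  · rw [mul_comm] at h1
    rw [mul_left_cancel₀ h0 h1, mul_comm]

theorem commute_units_conj_diagonal_comp {ι : Type*} [Fintype ι] [DecidableEq ι] {μ : ι → ℂ}
    {U : (Matrix ι ι ℂ)ˣ} {N : Matrix ι ι ℂ}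
    (h : Commute (U.val * Matrix.diagonal μ * U⁻¹.val) N) (f : ℂ → ℂ) :
    Commute (U.val * Matrix.diagonal (f ∘ μ) * U⁻¹.val) N := by
  have h1 : Commute (Matrix.diagonal μ) (U⁻¹.val * N * U.val) := by
    have := congrArg (fun x => U⁻¹.val * x * U.val) h.eq
    simpa [Commute, SemiconjBy, mul_assoc] using this
  have h2 := congrArg (fun x => U.val * x * U⁻¹.val) (commute_diagonal_comp h1 f).eq
  simpa [Commute, SemiconjBy, mul_assoc] using h2

/-- An element of the Lie algebra of the graph acts nilpotently as soon as it is orthogonal to the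
whole Lie algebra under the trace form: pairing it with its replica of complex conjugate
eigenvalues gives the sum of the squared absolute values of its eigenvalues. -/
theorem isNilpotent_of_trace_eq_zero
    {ρ : G →* GL (Fin d) ℂ}
    {X : Matrix (Fin n ⊕ Fin d) (Fin n ⊕ Fin d) ℂ} (hX : X ∈ tangentSpace (graphSet ρ))
    (h : ∀ Y ∈ tangentSpace (graphSet ρ), (X.toBlocks₂₂ * Y.toBlocks₂₂).trace = 0) :
    IsNilpotent X.toBlocks₂₂ := by
  obtain ⟨U₁, μ₁, N₁, hX₁, hN₁, hc₁⟩ := exists_units_diagonal_add_isNilpotent X.toBlocks₁₁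
  obtain ⟨U₂, μ₂, N₂, hX₂, hN₂, hc₂⟩ := exists_units_diagonal_add_isNilpotent X.toBlocks₂₂
  let U : (Matrix (Fin n ⊕ Fin d) (Fin n ⊕ Fin d) ℂ)ˣ :=
    ⟨Matrix.fromBlocks U₁.val 0 0 U₂.val, Matrix.fromBlocks U₁⁻¹.val 0 0 U₂⁻¹.val,
      by simp [Matrix.fromBlocks_multiply], by simp [Matrix.fromBlocks_multiply]⟩
  have hU : ∀ (ν₁ : Fin n → ℂ) (ν₂ : Fin d → ℂ),
      U.val * Matrix.diagonal (Sum.elim ν₁ ν₂) * U⁻¹.val =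
        Matrix.fromBlocks (U₁.val * Matrix.diagonal ν₁ * U₁⁻¹.val) 0 0
          (U₂.val * Matrix.diagonal ν₂ * U₂⁻¹.val) := by
    intro ν₁ ν₂
    change Matrix.fromBlocks U₁.val 0 0 U₂.val * _ * Matrix.fromBlocks U₁⁻¹.val 0 0 U₂⁻¹.val = _
    rw [← Matrix.fromBlocks_diagonal, Matrix.fromBlocks_multiply, Matrix.fromBlocks_multiply]
    simp
  let N := Matrix.fromBlocks N₁ 0 0 N₂
  have hN : IsNilpotent N := by
    obtain ⟨k, hk⟩ := hN₁
    obtain ⟨l, hl⟩ := hN₂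
    refine ⟨k + l, ?_⟩
    have : ∀ m : ℕ, N ^ m = Matrix.fromBlocks (N₁ ^ m) 0 0 (N₂ ^ m) := by
      intro m
      induction m with
      | zero => simp
      | succ m ih => rw [pow_succ, ih, pow_succ, pow_succ]; simp [N, Matrix.fromBlocks_multiply]
    rw [this, pow_add, hk, pow_add, hl]
    simp
  have hc : Commute (U.val * Matrix.diagonal (Sum.elim μ₁ μ₂) * U⁻¹.val) N := by
    rw [hU]
    simp only [Commute, SemiconjBy, N, Matrix.fromBlocks_multiply, hc₁.eq, hc₂.eq]
    simp
  have hXU : X = U.val * Matrix.diagonal (Sum.elim μ₁ μ₂) * U⁻¹.val + N := by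
    rw [hU, Matrix.fromBlocks_add, ← hX₁, ← hX₂]
    simpa using eq_fromBlocks_of_mem_tangentSpace hX
  set conj : ℂ →+ ℂ := (starRingEnd ℂ).toAddMonoidHom with hconj
  have hY : U.val * Matrix.diagonal (conj ∘ Sum.elim μ₁ μ₂) * U⁻¹.val ∈
      tangentSpace (graphSet ρ) := by
    refine mem_tangentSpace_of_eval_exp fun p hp s => ?_
    refine eval_exp_replica_eq_zero U _ hN hc conj (fun s => ?_) s
    rw [← hXU]
    exact eval_exp_eq_zero (one_mem_graphSet ρ) (mul_mem_graphSet ρ) hX hp s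
  have htr := h _ hY
  rw [Sum.comp_elim, hU, Matrix.toBlocks_fromBlocks₂₂] at htr
  have hnil : IsNilpotent (N₂ * (U₂.val * Matrix.diagonal (conj ∘ μ₂) * U₂⁻¹.val)) :=
    (commute_units_conj_diagonal_comp hc₂ conj).symm.isNilpotent_mul_right hN₂
  have hdiag : U₂.val * Matrix.diagonal μ₂ * U₂⁻¹.val *
      (U₂.val * Matrix.diagonal (conj ∘ μ₂) * U₂⁻¹.val) =
      U₂.val * (Matrix.diagonal fun i => ((‖μ₂ i‖ ^ 2 : ℝ) : ℂ)) * U₂⁻¹.val := by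
    have : Matrix.diagonal (fun i => ((‖μ₂ i‖ ^ 2 : ℝ) : ℂ)) =
        Matrix.diagonal μ₂ * Matrix.diagonal (conj ∘ μ₂) := by
      rw [Matrix.diagonal_mul_diagonal]
      congr 1
      ext i
      simp [hconj, Complex.mul_conj']
    rw [this]
    simp only [mul_assoc, Units.inv_mul_cancel_left]
  rw [hX₂, add_mul, Matrix.trace_add, (Matrix.isNilpotent_trace_of_isNilpotent hnil).eq_zero,
    add_zero, hdiag, Matrix.trace_mul_comm, ← mul_assoc, Units.inv_mul, one_mul,
    Matrix.trace_diagonal, ← Complex.ofReal_sum, Complex.ofReal_eq_zero,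
    Finset.sum_eq_zero_iff_of_nonneg fun i _ => by positivity] at htr
  have hμ : μ₂ = 0 := by
    ext i
    simpa using htr i (Finset.mem_univ i)
  rw [hX₂, hμ]
  simpa using hN₂

/-- The radical of the trace form on the Lie algebra of the graph. -/
def traceRadical (ρ : G →* GL (Fin d) ℂ) :
    Submodule ℂ (Matrix (Fin n ⊕ Fin d) (Fin n ⊕ Fin d) ℂ) where
  carrier := {X | X ∈ tangentSpace (graphSet ρ) ∧
    ∀ Y ∈ tangentSpace (graphSet ρ), (X.toBlocks₂₂ * Y.toBlocks₂₂).trace = 0}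
  add_mem' {X X'} hX hX' := ⟨add_mem hX.1 hX'.1, fun Y hY => by
    have : (X + X').toBlocks₂₂ = X.toBlocks₂₂ + X'.toBlocks₂₂ := rfl
    rw [this, add_mul, Matrix.trace_add, hX.2 Y hY, hX'.2 Y hY, add_zero]⟩
  zero_mem' := ⟨zero_mem _, fun Y _ => by
    have : (0 : Matrix (Fin n ⊕ Fin d) (Fin n ⊕ Fin d) ℂ).toBlocks₂₂ = 0 := rfl
    rw [this, zero_mul, Matrix.trace_zero]⟩
  smul_mem' c X hX := ⟨Submodule.smul_mem _ c hX.1, fun Y hY => by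
    have : (c • X).toBlocks₂₂ = c • X.toBlocks₂₂ := rfl
    rw [this, smul_mul_assoc, Matrix.trace_smul, hX.2 Y hY, smul_zero]⟩

theorem conj_mem_traceRadical {ρ : G →* GL (Fin d) ℂ}
    {X : Matrix (Fin n ⊕ Fin d) (Fin n ⊕ Fin d) ℂ} (hX : X ∈ traceRadical ρ) (g : G) :
    Matrix.fromBlocks (g : GL (Fin n) ℂ).val 0 0 (ρ g).val * X *
      Matrix.fromBlocks (g : GL (Fin n) ℂ)⁻¹.val 0 0 (ρ g)⁻¹.val ∈ traceRadical ρ := by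
  refine ⟨conj_mem_tangentSpace_graphSet hX.1 g, fun Y hY => ?_⟩
  have h := hX.2 _ (conj_mem_tangentSpace_graphSet hY g⁻¹)
  rw [toBlocks₂₂_conj hY] at h
  rw [toBlocks₂₂_conj hX.1, mul_assoc, mul_assoc, Matrix.trace_mul_comm]
  simpa [mul_assoc] using h

theorem toBlocks₂₂_commutator {ρ : G →* GL (Fin d) ℂ}
    {X Y : Matrix (Fin n ⊕ Fin d) (Fin n ⊕ Fin d) ℂ} (hX : X ∈ tangentSpace (graphSet ρ))
    (hY : Y ∈ tangentSpace (graphSet ρ)) : (X * Y - Y * X).toBlocks₂₂ =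
      X.toBlocks₂₂ * Y.toBlocks₂₂ - Y.toBlocks₂₂ * X.toBlocks₂₂ := by
  conv_lhs => rw [eq_fromBlocks_of_mem_tangentSpace hX, eq_fromBlocks_of_mem_tangentSpace hY]
  rw [Matrix.fromBlocks_multiply, Matrix.fromBlocks_multiply]
  ext i j
  simp [Matrix.toBlocks₂₂]

/-- One-parameter subgroups of a finite kernel are trivial, because they are divisible. -/
theorem apply_eq_one_of_ker_finite {Γ Δ : Type*} [Group Γ] [Group Δ] {ρ : Γ →* Δ}
    (hker : (ρ.ker : Set Γ).Finite) {b : ℝ → Γ} (hb : ∀ s t, b (s + t) = b s * b t)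
    (h : ∀ t, ρ (b t) = 1) (t : ℝ) : b t = 1 := by
  have : Finite ρ.ker := hker
  set m := Nat.card ρ.ker with hm
  have hm0 : (m : ℝ) ≠ 0 := by exact_mod_cast Nat.card_pos.ne'
  have hb0 : b 0 = 1 := by
    have := hb 0 0
    rwa [add_zero, left_eq_mul] at this
  have hpow : ∀ (s : ℝ) (k : ℕ), b (k * s) = b s ^ k := by
    intro s k
    induction k with
    | zero => simpa using hb0
    | succ k ih => rw [Nat.cast_succ, add_mul, one_mul, hb, ih, pow_succ]
  have h4 : (⟨b (t / m), h _⟩ : ρ.ker) ^ m = 1 := pow_card_eq_one'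
  have h5 : b (t / m) ^ m = 1 := congrArg (fun g : ρ.ker => (g : Γ)) h4
  rwa [← hpow, mul_div_cancel₀ _ hm0] at h5

/-- A vector of the Lie algebra of the graph that acts trivially vanishes if `ρ` has finite
kernel. -/
theorem eq_zero_of_toBlocks₂₂_eq_zero (hG : IsZariskiClosed ℚ (G : Set (GL (Fin n) ℂ)))
    {ρ : G →* GL (Fin d) ℂ} (hρ : IsRationalQ ρ) (hker : (ρ.ker : Set G).Finite)
    {X : Matrix (Fin n ⊕ Fin d) (Fin n ⊕ Fin d) ℂ} (hX : X ∈ tangentSpace (graphSet ρ))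
    (h : X.toBlocks₂₂ = 0) : X = 0 := by
  have hmem := fun s : ℝ => exists_expUnit_of_mem_tangentSpace hG hρ hX s
  have h1 : X.toBlocks₁₁ = 0 := by
    refine eq_zero_of_exp_real_smul_eq_one fun s => ?_
    have h2 := apply_eq_one_of_ker_finite hker (b := fun s : ℝ => ⟨_, (hmem s).1⟩) (fun s t => by
      ext1
      ext1
      change NormedSpace.exp (((s + t : ℝ) : ℂ) • X.toBlocks₁₁) = _
      rw [Complex.ofReal_add, exp_smul_add]
      rfl) (fun s => by
      ext1
      rw [(hmem s).2, h, smul_zero, NormedSpace.exp_zero]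
      rfl) s
    exact congrArg (fun g : G => (g : GL (Fin n) ℂ).val) h2
  rw [eq_fromBlocks_of_mem_tangentSpace hX, h1, h]
  simp

attribute [local instance] LieRing.ofAssociativeRing in
/-- The trace form on the Lie algebra of the graph is nondegenerate when `ρ` is irreducible with
finite kernel: its radical is an ideal of nilpotent endomorphisms, which annihilates a nonzero
vector by Engel's theorem, hence everything. -/
theorem eq_zero_of_mem_traceRadical (hG : IsZariskiClosed ℚ (G : Set (GL (Fin n) ℂ)))
    {ρ : G →* GL (Fin d) ℂ} (hρ : IsRationalQ ρ) (hirr : IsIrreducibleRep ρ)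
    (hker : (ρ.ker : Set G).Finite)
    {X : Matrix (Fin n ⊕ Fin d) (Fin n ⊕ Fin d) ℂ} (hX : X ∈ traceRadical ρ) : X = 0 := by
  let φ : Matrix (Fin n ⊕ Fin d) (Fin n ⊕ Fin d) ℂ →ₗ[ℂ] Module.End ℂ (Fin d → ℂ) :=
    { toFun := fun X => Matrix.toLinAlgEquiv' X.toBlocks₂₂
      map_add' := fun X Y => map_add Matrix.toLinAlgEquiv' X.toBlocks₂₂ Y.toBlocks₂₂
      map_smul' := fun c X => map_smul Matrix.toLinAlgEquiv' c X.toBlocks₂₂ }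
  let L : LieSubalgebra ℂ (Module.End ℂ (Fin d → ℂ)) :=
    { (traceRadical ρ).map φ with
      lie_mem' := by
        rintro _ _ ⟨X, hX, rfl⟩ ⟨Y, hY, rfl⟩
        refine ⟨X * Y - Y * X, ⟨commutator_mem_tangentSpace_graphSet hG hρ hX.1 hY.1,
          fun W hW => ?_⟩, ?_⟩
        · have h := hX.2 _ (commutator_mem_tangentSpace_graphSet hG hρ hY.1 hW)
          rw [toBlocks₂₂_commutator hY.1 hW, mul_sub, Matrix.trace_sub] at h
          rw [toBlocks₂₂_commutator hX.1 hY.1, sub_mul, Matrix.trace_sub, mul_assoc,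
            Matrix.trace_mul_comm (Y.toBlocks₂₂ * X.toBlocks₂₂),
            ← mul_assoc W.toBlocks₂₂, Matrix.trace_mul_comm (W.toBlocks₂₂ * Y.toBlocks₂₂)]
          exact h
        · change Matrix.toLinAlgEquiv' (X * Y - Y * X).toBlocks₂₂ = _
          rw [toBlocks₂₂_commutator hX.1 hY.1, map_sub, map_mul, map_mul]
          rfl }
  have hL : ∀ X ∈ traceRadical ρ, φ X ∈ L := fun X hX => ⟨X, hX, rfl⟩
  have : NeZero d := ⟨hirr.1.ne'⟩
  have hnil : LieModule.IsNilpotent L (Fin d → ℂ) := by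
    rw [LieModule.isNilpotent_iff_forall (R := ℂ)]
    rintro ⟨_, X, hX, rfl⟩
    have h := (isNilpotent_of_trace_eq_zero hX.1 hX.2).map
      (Matrix.toLinAlgEquiv' (R := ℂ) (n := Fin d))
    exact h
  have hnt := LieModule.nontrivial_max_triv_of_isNilpotent ℂ L (Fin d → ℂ)
  let W : Submodule ℂ (Fin d → ℂ) := LieModule.maxTrivSubmodule ℂ L (Fin d → ℂ)
  have hW : ∀ v, v ∈ W ↔ ∀ X ∈ traceRadical ρ, X.toBlocks₂₂.mulVec v = 0 := by
    intro v
    change v ∈ LieModule.maxTrivSubmodule ℂ L (Fin d → ℂ) ↔ _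
    rw [LieModule.mem_maxTrivSubmodule]
    constructor
    · intro h X hX
      exact h ⟨φ X, hL X hX⟩
    · rintro h ⟨_, X, hX, rfl⟩
      exact h X hX
  have hWtop : W = ⊤ := by
    refine (hirr.2 W fun g v hv => ?_).resolve_left fun hbot => ?_
    · rw [hW] at hv ⊢
      intro X hX
      have h1 := hv _ (conj_mem_traceRadical hX g⁻¹)
      rw [toBlocks₂₂_conj hX.1] at h1
      have h2 := congrArg (fun v => (ρ g).val.mulVec v) h1
      simpa [Matrix.mulVec_mulVec, ← mul_assoc] using h2
    · obtain ⟨v, hv⟩ := exists_ne (0 : LieModule.maxTrivSubmodule ℂ L (Fin d → ℂ))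
      have : (v : Fin d → ℂ) ∈ W := v.2
      rw [hbot, Submodule.mem_bot] at this
      exact hv (Subtype.ext this)
  refine eq_zero_of_toBlocks₂₂_eq_zero hG hρ hker hX.1 ?_
  refine Matrix.ext_of_mulVec_single fun i => ?_
  rw [(hW _).1 (hWtop ▸ Submodule.mem_top) X hX, Matrix.zero_mulVec]

/-- Every element of the Lie algebra of a semisimple group acts with trace zero in an irreducible
representation with finite kernel: the trace form represents the trace by an element of the Lie
algebra, which is central because the trace is invariant under conjugation. -/
theorem trace_toBlocks₂₂_eq_zero (hG : IsConnectedSemisimpleQ G)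
    {ρ : G →* GL (Fin d) ℂ} (hρ : IsRationalQ ρ) (hirr : IsIrreducibleRep ρ)
    (hker : (ρ.ker : Set G).Finite)
    {A : Matrix (Fin n ⊕ Fin d) (Fin n ⊕ Fin d) ℂ} (hA : A ∈ tangentSpace (graphSet ρ)) :
    A.toBlocks₂₂.trace = 0 := by
  let 𝔤 := tangentSpace (graphSet ρ)
  let B : 𝔤 →ₗ[ℂ] Module.Dual ℂ 𝔤 := LinearMap.mk₂ ℂ
    (fun X Y => (X.val.toBlocks₂₂ * Y.val.toBlocks₂₂).trace)
    (fun X X' Y => by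
      rw [← Matrix.trace_add, ← add_mul]; rfl)
    (fun c X Y => by
      rw [← Matrix.trace_smul, ← smul_mul_assoc]; rfl)
    (fun X Y Y' => by
      rw [← Matrix.trace_add, ← mul_add]; rfl)
    (fun c X Y => by
      rw [← Matrix.trace_smul, ← mul_smul_comm]; rfl)
  let τ : Module.Dual ℂ 𝔤 :=
    { toFun := fun X => X.val.toBlocks₂₂.trace
      map_add' := fun X Y => Matrix.trace_add X.val.toBlocks₂₂ Y.val.toBlocks₂₂
      map_smul' := fun c X => Matrix.trace_smul c X.val.toBlocks₂₂ }
  have hBinj : Function.Injective B := by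
    rw [injective_iff_map_eq_zero]
    intro X hX
    refine Subtype.ext (eq_zero_of_mem_traceRadical hG.closed hρ hirr hker ⟨X.2, fun Y hY => ?_⟩)
    exact LinearMap.congr_fun hX ⟨Y, hY⟩
  have hBsurj : Function.Surjective B :=
    (LinearMap.injective_iff_surjective_of_finrank_eq_finrank
      Subspace.dual_finrank_eq.symm).1 hBinj
  obtain ⟨Z, hZ⟩ := hBsurj τ
  have hZY : ∀ Y ∈ 𝔤, (Z.val.toBlocks₂₂ * Y.toBlocks₂₂).trace = Y.toBlocks₂₂.trace :=
    fun Y hY => LinearMap.congr_fun hZ ⟨Y, hY⟩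
  have hcomm : ∀ g ∈ G, Commute g.val Z.val.toBlocks₁₁ := by
    intro g hg
    have hconj := conj_mem_tangentSpace_graphSet Z.2 ⟨g, hg⟩
    have h1 : (⟨_, hconj⟩ : 𝔤) = Z := by
      refine hBinj (LinearMap.ext fun Y => ?_)
      rw [hZ]
      change (Matrix.toBlocks₂₂ (_ * _ * _) * Y.val.toBlocks₂₂).trace = Y.val.toBlocks₂₂.trace
      rw [toBlocks₂₂_conj Z.2]
      have h2 := hZY _ (conj_mem_tangentSpace_graphSet Y.2 ⟨g, hg⟩⁻¹)
      rw [toBlocks₂₂_conj Y.2, Matrix.trace_mul_comm _ (Units.val _), ← mul_assoc] at h2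
      rw [mul_assoc, mul_assoc, Matrix.trace_mul_comm]
      simpa [mul_assoc] using h2
    have h3 := congrArg (fun X : 𝔤 => X.val.toBlocks₁₁) h1
    simp only at h3
    rw [eq_fromBlocks_of_mem_tangentSpace Z.2] at h3
    simp only [Matrix.fromBlocks_multiply, Matrix.toBlocks_fromBlocks₁₁] at h3
    have h4 := congrArg (· * g.val) h3
    simpa [Commute, SemiconjBy, mul_assoc] using h4
  have hZ0 : Z.val.toBlocks₁₁ = 0 :=
    hG.eq_zero_of_exp_central
      (fun s => (exists_expUnit_of_mem_tangentSpace hG.closed hρ Z.2 s).1) hcomm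
  -- `ρ` is trivial on `exp (s • 0) = 1`, so that the second component of `Z` vanishes as well
  have hZ2 : Z.val.toBlocks₂₂ = 0 := by
    refine eq_zero_of_exp_real_smul_eq_one fun s => ?_
    obtain ⟨h1, h2⟩ := exists_expUnit_of_mem_tangentSpace hG.closed hρ Z.2 s
    have h3 : (⟨_, h1⟩ : G) = 1 := by
      ext1
      ext1
      simp [expUnit, hZ0, NormedSpace.exp_zero]
    rw [← h2, h3, map_one]
    rfl
  rw [← hZY A hA, hZ2, zero_mul, Matrix.trace_zero]

end TraceForm
end

noncomputable section

/-! ### Weights of a split torus -/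

section Torus
variable {n d : ℕ} {G T : Subgroup (GL (Fin n) ℂ)}

/-- The diagonal entries of `h * t * h⁻¹`, as characters of a group `T` that is diagonalized
by `h`. -/
def coordChar (h : GL (Fin n) ℂ) (hd : ∀ t ∈ T, (h * t * h⁻¹).val.IsDiag) (i : Fin n) :
    T →* ℂˣ where
  toFun t := ⟨(h * t * h⁻¹).val i i, (h * t⁻¹ * h⁻¹).val i i, by
    have h1 : (h * t * h⁻¹).val * (h * (t : GL (Fin n) ℂ)⁻¹ * h⁻¹).val = 1 := by
      rw [← Units.val_mul]; simp [mul_assoc]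
    have h2 := congrFun (congrFun h1 i) i
    rwa [← (hd t t.2).diagonal_diag, Matrix.diagonal_mul, Matrix.one_apply_eq] at h2, by
    have h1 : (h * (t : GL (Fin n) ℂ)⁻¹ * h⁻¹).val * (h * t * h⁻¹).val = 1 := by
      rw [← Units.val_mul]; simp [mul_assoc]
    have h2 := congrFun (congrFun h1 i) i
    rwa [← (hd t t.2).diagonal_diag, Matrix.mul_diagonal, Matrix.one_apply_eq] at h2⟩
  map_one' := by ext; simp
  map_mul' s t := by
    ext
    have h1 : (h * (s * t : T) * h⁻¹).val = (h * s * h⁻¹).val * (h * t * h⁻¹).val := by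
      rw [← Units.val_mul]; simp [mul_assoc]
    have h2 := congrFun (congrFun h1 i) i
    rwa [← (hd s s.2).diagonal_diag, Matrix.diagonal_mul] at h2

theorem eq_conj_diagonal_coordChar (h : GL (Fin n) ℂ) (hd : ∀ t ∈ T, (h * t * h⁻¹).val.IsDiag)
    (t : T) : (t : GL (Fin n) ℂ).val =
      h⁻¹.val * Matrix.diagonal (fun i => ((coordChar h hd i t : ℂˣ) : ℂ)) * h.val := by
  have h1 : Matrix.diagonal (fun i => ((coordChar h hd i t : ℂˣ) : ℂ)) = (h * t * h⁻¹).val :=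
    (hd t t.2).diagonal_diag
  rw [h1, ← Units.val_mul, ← Units.val_mul]
  congr 1
  group

/-- On a split torus the matrix coefficients of a rational representation are linear combinations
of products of coordinate characters and their inverses. -/
theorem exists_finsupp_entry (h : GL (Fin n) ℂ) (hd : ∀ t ∈ T, (h * t * h⁻¹).val.IsDiag)
    (hTG : T ≤ G) {ρ : G →* GL (Fin d) ℂ} (hρ : IsRationalQ ρ) (i j : Fin d) :
    ∃ c : Subgroup.closure (Set.range (coordChar h hd)) →₀ ℂ, ∀ t : T,
      (ρ (Subgroup.inclusion hTG t)).val i j =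
        c.sum fun χ z => z * ((χ.1 t : ℂˣ) : ℂ) := by
  classical
  let 𝒳 := Subgroup.closure (Set.range (coordChar h hd))
  let φ : 𝒳 →* (T → ℂ) :=
    { toFun := fun χ t => ((χ.1 t : ℂˣ) : ℂ)
      map_one' := by ext; simp
      map_mul' := fun χ χ' => by ext; simp }
  let A : Subalgebra ℂ (T → ℂ) := Algebra.adjoin ℂ (Set.range φ)
  have hφA : ∀ χ, φ χ ∈ A := fun χ => Algebra.subset_adjoin ⟨χ, rfl⟩
  have hent : ∀ k l : Fin n, (fun t : T => (t : GL (Fin n) ℂ).val k l) ∈ A := by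
    intro k l
    have : (fun t : T => (t : GL (Fin n) ℂ).val k l) =
        ∑ m, (h⁻¹.val k m * h.val m l) •
          φ ⟨coordChar h hd m, Subgroup.subset_closure ⟨m, rfl⟩⟩ := by
      ext t
      rw [eq_conj_diagonal_coordChar h hd t]
      rw [Matrix.mul_apply, Finset.sum_apply]
      refine Finset.sum_congr rfl fun m _ => ?_
      rw [Matrix.mul_diagonal, Pi.smul_apply, smul_eq_mul]
      change _ * ((coordChar h hd m t : ℂˣ) : ℂ) * _ = _ * ((coordChar h hd m t : ℂˣ) : ℂ)
      ring
    rw [this]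
    exact sum_mem fun m _ => A.smul_mem (hφA _) _
  have hpoly : ∀ p : MvPolynomial (Fin n × Fin n) ℚ, (fun t : T =>
      MvPolynomial.aeval (fun ij : Fin n × Fin n => (t : GL (Fin n) ℂ).val ij.1 ij.2) p) ∈ A := by
    intro p
    induction p using MvPolynomial.induction_on with
    | C a =>
      have : (fun t : T => MvPolynomial.aeval (fun ij : Fin n × Fin n =>
          (t : GL (Fin n) ℂ).val ij.1 ij.2) (MvPolynomial.C a : MvPolynomial (Fin n × Fin n) ℚ)) =
          algebraMap ℂ (T → ℂ) (algebraMap ℚ ℂ a) := by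
        ext t; simp
      rw [this]
      exact A.algebraMap_mem _
    | add p q hp hq =>
      simp only [map_add]
      exact A.add_mem hp hq
    | mul_X p ij hp =>
      simp only [map_mul, MvPolynomial.aeval_X]
      exact A.mul_mem hp (hent _ _)
  have hdet : (fun t : T => ((t : GL (Fin n) ℂ).val.det)⁻¹) ∈ A := by
    have : (fun t : T => ((t : GL (Fin n) ℂ).val.det)⁻¹) =
        φ (∏ m, ⟨coordChar h hd m, Subgroup.subset_closure ⟨m, rfl⟩⟩)⁻¹ := by
      ext t
      have h1 : (t : GL (Fin n) ℂ).val.det = ∏ m, ((coordChar h hd m t : ℂˣ) : ℂ) := by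
        rw [eq_conj_diagonal_coordChar h hd t, Matrix.det_mul_comm, ← mul_assoc, Units.mul_inv,
          one_mul, Matrix.det_diagonal]
      rw [h1]
      simp [φ]
    rw [this]
    exact hφA _
  obtain ⟨p, m, hp⟩ := hρ i j
  have hmem : (fun t : T => (ρ (Subgroup.inclusion hTG t)).val i j) ∈ A := by
    have : (fun t : T => (ρ (Subgroup.inclusion hTG t)).val i j) =
        (fun t : T => MvPolynomial.aeval
          (fun ij : Fin n × Fin n => (t : GL (Fin n) ℂ).val ij.1 ij.2) p) *
        (fun t : T => ((t : GL (Fin n) ℂ).val.det)⁻¹) ^ m := by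
      ext t
      exact hp _
    rw [this]
    exact A.mul_mem (hpoly p) (A.pow_mem hdet m)
  have hspan : (fun t : T => (ρ (Subgroup.inclusion hTG t)).val i j) ∈
      Submodule.span ℂ (Set.range φ) := by
    have h1 : Subalgebra.toSubmodule A = Submodule.span ℂ (Set.range φ) := by
      rw [Algebra.adjoin_eq_span, ← MonoidHom.coe_mrange, Submonoid.closure_eq]
    rw [← h1]
    exact hmem
  obtain ⟨c, hc⟩ := Finsupp.mem_span_range_iff_exists_finsupp.1 hspan
  refine ⟨c, fun t => ?_⟩
  have := congrFun hc t
  simp only [Finsupp.sum, Finset.sum_apply, Pi.smul_apply, smul_eq_mul] at this ⊢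
  exact this.symm

theorem eq_zero_of_sum_character_smul_eq_zero {V : Type*} {m : Type*} [Group V]
    (F : Finset (V →* ℂˣ)) (D : (V →* ℂˣ) → Matrix m m ℂ)
    (h : ∀ t : V, ∑ χ ∈ F, ((χ t : ℂˣ) : ℂ) • D χ = 0) : ∀ χ ∈ F, D χ = 0 := by
  have hli : LinearIndependent ℂ fun χ : V →* ℂˣ => (fun t => ((χ t : ℂˣ) : ℂ) : V → ℂ) := by
    have := (linearIndependent_monoidHom V ℂ).comp
      (fun χ : V →* ℂˣ => (Units.coeHom ℂ).comp χ) (fun χ χ' h => by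
        ext t
        exact DFunLike.congr_fun h t)
    exact this
  intro χ hχ
  ext i j
  refine linearIndependent_iff'.1 hli F (fun χ => D χ i j) ?_ χ hχ
  ext t
  have := congrFun (congrFun (h t) i) j
  simpa [Finset.sum_apply, Matrix.sum_apply, mul_comm] using this

/-- **Weight space decomposition** of a rational representation over a split torus: `C χ` is the
projection to the weight space of `χ`. The last clause records that the weights are products of
coordinate characters and their inverses. -/
theorem exists_weight_projections (h : GL (Fin n) ℂ) (hd : ∀ t ∈ T, (h * t * h⁻¹).val.IsDiag)
    (hTG : T ≤ G) {ρ : G →* GL (Fin d) ℂ} (hρ : IsRationalQ ρ) :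
    ∃ (F : Finset (T →* ℂˣ)) (C : (T →* ℂˣ) → Matrix (Fin d) (Fin d) ℂ),
      ∑ χ ∈ F, C χ = 1 ∧
      (∀ χ ∈ F, ∀ t, (ρ (Subgroup.inclusion hTG t)).val * C χ = ((χ t : ℂˣ) : ℂ) • C χ) ∧
      (∀ χ ∈ F, ∀ t, C χ * (ρ (Subgroup.inclusion hTG t)).val = ((χ t : ℂˣ) : ℂ) • C χ) ∧
      (∀ χ ∈ F, C χ * C χ = C χ) ∧ (∀ χ ∈ F, C χ ≠ 0) ∧
      ∀ χ ∈ F, χ ∈ Subgroup.closure (Set.range (coordChar h hd)) := by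
  classical
  choose c hc using exists_finsupp_entry h hd hTG hρ
  let C₀ : (T →* ℂˣ) → Matrix (Fin d) (Fin d) ℂ := fun χ =>
    Matrix.of fun i j => if hχ : χ ∈ Subgroup.closure (Set.range (coordChar h hd)) then
      c i j ⟨χ, hχ⟩ else 0
  let F₀ : Finset (T →* ℂˣ) := Finset.univ.biUnion fun ij : Fin d × Fin d =>
    (c ij.1 ij.2).support.map (Function.Embedding.subtype _)
  have hsum₀ : ∀ t, (ρ (Subgroup.inclusion hTG t)).val = ∑ χ ∈ F₀, ((χ t : ℂˣ) : ℂ) • C₀ χ := by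
    intro t
    ext i j
    rw [hc, Matrix.sum_apply, Finsupp.sum]
    have hsub : (c i j).support.map (Function.Embedding.subtype _) ⊆ F₀ :=
      Finset.subset_biUnion_of_mem (fun ij : Fin d × Fin d =>
        (c ij.1 ij.2).support.map (Function.Embedding.subtype _)) (Finset.mem_univ (i, j))
    rw [← Finset.sum_subset hsub]
    · rw [Finset.sum_map]
      refine Finset.sum_congr rfl fun χ _ => ?_
      simp [C₀, mul_comm]
    · intro χ _ hχ
      by_cases hmem : χ ∈ Subgroup.closure (Set.range (coordChar h hd))
      · have : c i j ⟨χ, hmem⟩ = 0 := by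
          by_contra h0
          exact hχ (Finset.mem_map.2 ⟨⟨χ, hmem⟩, Finsupp.mem_support_iff.2 h0, rfl⟩)
        simp [C₀, hmem, this]
      · simp [C₀, hmem]
  have hmul : ∀ s t : T, (ρ (Subgroup.inclusion hTG (s * t))).val =
      (ρ (Subgroup.inclusion hTG s)).val * (ρ (Subgroup.inclusion hTG t)).val := by
    intro s t
    rw [map_mul, map_mul, Units.val_mul]
  have hright : ∀ χ ∈ F₀, ∀ t, C₀ χ * (ρ (Subgroup.inclusion hTG t)).val =
      ((χ t : ℂˣ) : ℂ) • C₀ χ := by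
    intro χ hχ t
    refine sub_eq_zero.1 (eq_zero_of_sum_character_smul_eq_zero F₀ (fun χ =>
      C₀ χ * (ρ (Subgroup.inclusion hTG t)).val - ((χ t : ℂˣ) : ℂ) • C₀ χ) (fun s => ?_) χ hχ)
    simp only [smul_sub, Finset.sum_sub_distrib, ← smul_mul_assoc, ← Finset.sum_mul, ← hsum₀,
      smul_smul]
    rw [← hmul, hsum₀ (s * t), sub_eq_zero]
    simp
  have hleft : ∀ χ ∈ F₀, ∀ t, (ρ (Subgroup.inclusion hTG t)).val * C₀ χ =
      ((χ t : ℂˣ) : ℂ) • C₀ χ := by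
    intro χ hχ t
    refine sub_eq_zero.1 (eq_zero_of_sum_character_smul_eq_zero F₀ (fun χ =>
      (ρ (Subgroup.inclusion hTG t)).val * C₀ χ - ((χ t : ℂˣ) : ℂ) • C₀ χ) (fun s => ?_) χ hχ)
    simp only [smul_sub, Finset.sum_sub_distrib, ← mul_smul_comm, ← Finset.mul_sum, ← hsum₀]
    rw [← hmul, hsum₀ (t * s), sub_eq_zero]
    refine Finset.sum_congr rfl fun χ _ => ?_
    simp [smul_smul, mul_comm]
  have hidem : ∀ χ ∈ F₀, C₀ χ * C₀ χ = C₀ χ := by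
    intro χ hχ
    have h1 := eq_zero_of_sum_character_smul_eq_zero F₀ (fun χ' =>
      C₀ χ * C₀ χ' - if χ' = χ then C₀ χ else 0) (fun t => by
        simp only [smul_sub, Finset.sum_sub_distrib, ← mul_smul_comm, ← Finset.mul_sum, ← hsum₀,
          smul_ite, smul_zero, Finset.sum_ite_eq', hχ, if_true]
        rw [hright χ hχ, sub_self]) χ hχ
    simpa [sub_eq_zero] using h1
  refine ⟨F₀.filter fun χ => C₀ χ ≠ 0, C₀, ?_, fun χ hχ => hleft χ (Finset.mem_filter.1 hχ).1,
    fun χ hχ => hright χ (Finset.mem_filter.1 hχ).1,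
    fun χ hχ => hidem χ (Finset.mem_filter.1 hχ).1,
    fun χ hχ => (Finset.mem_filter.1 hχ).2, fun χ hχ => ?_⟩
  · rw [Finset.sum_filter_ne_zero]
    have := hsum₀ 1
    simpa using this.symm
  · by_contra hmem
    refine (Finset.mem_filter.1 hχ).2 ?_
    ext i j
    simp [C₀, hmem]

end Torus
end

noncomputable section

/-! ### Growth along the one-parameter subgroup -/

section OneParameter
variable {n d : ℕ} {G T : Subgroup (GL (Fin n) ℂ)}

theorem exists_eq_exp_mul {f : ℝ → ℝ} (hc : Continuous f) (hpos : ∀ t, 0 < f t)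
    (hmul : ∀ s t, f (s + t) = f s * f t) : ∃ c : ℝ, ∀ t, f t = Real.exp (c * t) := by
  let L : ℝ →+ ℝ := AddMonoidHom.mk' (fun t => Real.log (f t)) fun s t => by
    rw [hmul, Real.log_mul (hpos s).ne' (hpos t).ne']
  have hL : Continuous L := hc.log fun t => (hpos t).ne'
  refine ⟨L 1, fun t => ?_⟩
  have h := map_real_smul L hL t 1
  rw [smul_eq_mul, mul_one, smul_eq_mul, mul_comm] at h
  rw [← h]
  exact (Real.exp_log (hpos t)).symm

theorem IsOneParameterSubgroup.map_zero {a : ℝ → T} (ha : IsOneParameterSubgroup a) : a 0 = 1 := by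
  have := ha.map_add 0 0
  rwa [add_zero, left_eq_mul] at this

theorem IsOneParameterSubgroup.continuous_val {a : ℝ → T} (ha : IsOneParameterSubgroup a) :
    Continuous fun t => (a t : GL (Fin n) ℂ).val :=
  Units.continuous_val.comp (continuous_subtype_val.comp ha.continuous)

theorem IsOneParameterSubgroup.inv_eq {a : ℝ → T} (ha : IsOneParameterSubgroup a) (t : ℝ) :
    (a t)⁻¹ = a (-t) := by
  rw [inv_eq_iff_mul_eq_one, ← ha.map_add, add_neg_cancel, ha.map_zero]

/-- The coordinate characters of a torus split over `ℚ` are real and positive on `a t`. -/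
theorem exists_coordChar_eq_exp (H : GL (Fin n) ℚ) (hd : ∀ t ∈ T,
      (Matrix.GeneralLinearGroup.map (algebraMap ℚ ℂ) H * t *
        (Matrix.GeneralLinearGroup.map (algebraMap ℚ ℂ) H)⁻¹).val.IsDiag)
    {a : ℝ → T} (ha : IsOneParameterSubgroup a) (i : Fin n) :
    ∃ c : ℝ, ∀ t, ((coordChar _ hd i (a t) : ℂˣ) : ℂ) = (Real.exp (c * t) : ℝ) := by
  set h := Matrix.GeneralLinearGroup.map (n := Fin n) (algebraMap ℚ ℂ) H with hh
  have hreal : ∀ t, ∃ r : ℝ, ((coordChar h hd i (a t) : ℂˣ) : ℂ) = r := by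
    intro t
    obtain ⟨g₀, hg₀⟩ := ha.real t
    let hR := Matrix.GeneralLinearGroup.map (n := Fin n) (algebraMap ℚ ℝ) H
    have h1 : Matrix.GeneralLinearGroup.map Complex.ofRealHom hR = h := by
      ext i j
      simp [hR, hh]
    refine ⟨(hR * g₀ * hR⁻¹).val i i, ?_⟩
    change (h * (a t : GL (Fin n) ℂ) * h⁻¹).val i i = _
    rw [← h1, ← hg₀, ← map_mul, ← map_inv, ← map_mul]
    rfl
  choose f hf using hreal
  have hmul : ∀ s t, f (s + t) = f s * f t := by
    intro s t
    have : ((f (s + t) : ℝ) : ℂ) = f s * f t := by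
      rw [← hf, ← hf, ← hf, ha.map_add, map_mul, Units.val_mul]
    exact_mod_cast this
  have hne : ∀ t, f t ≠ 0 := fun t h0 => (coordChar h hd i (a t)).ne_zero (by rw [hf, h0]; simp)
  have hpos : ∀ t, 0 < f t := by
    intro t
    have := hmul (t / 2) (t / 2)
    rw [add_halves] at this
    rw [this]
    exact mul_self_pos.2 (hne _)
  have hcont : Continuous f := by
    have h1 : Continuous fun t => (h.val * (a t : GL (Fin n) ℂ).val * h⁻¹.val) i i :=
      ((continuous_const.mul ha.continuous_val).mul continuous_const).matrix_elem i i
    have h2 : f = fun t => ((h.val * (a t : GL (Fin n) ℂ).val * h⁻¹.val) i i).re := by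
      ext t
      exact (Complex.ofReal_re (f t)).symm.trans (congrArg Complex.re (hf t).symm)
    rw [h2]
    exact Complex.continuous_re.comp h1
  obtain ⟨c, hc⟩ := exists_eq_exp_mul hcont hpos hmul
  exact ⟨c, fun t => by rw [hf, hc]⟩

theorem exists_eq_exp_of_mem_closure {h : GL (Fin n) ℂ}
    {hd : ∀ t ∈ T, (h * t * h⁻¹).val.IsDiag} {a : ℝ → T}
    (hcoord : ∀ i, ∃ c : ℝ, ∀ t, ((coordChar h hd i (a t) : ℂˣ) : ℂ) = (Real.exp (c * t) : ℝ))
    {χ : T →* ℂˣ} (hχ : χ ∈ Subgroup.closure (Set.range (coordChar h hd))) :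
    ∃ c : ℝ, ∀ t, ((χ (a t) : ℂˣ) : ℂ) = (Real.exp (c * t) : ℝ) := by
  induction hχ using Subgroup.closure_induction with
  | mem χ hχ =>
    obtain ⟨i, rfl⟩ := hχ
    exact hcoord i
  | one => exact ⟨0, fun t => by simp⟩
  | mul χ χ' _ _ h₁ h₂ =>
    obtain ⟨c, hc⟩ := h₁
    obtain ⟨c', hc'⟩ := h₂
    exact ⟨c + c', fun t => by
      rw [MonoidHom.mul_apply, Units.val_mul, hc, hc', add_mul, Real.exp_add, Complex.ofReal_mul]⟩
  | inv χ _ h₁ =>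
    obtain ⟨c, hc⟩ := h₁
    exact ⟨-c, fun t => by
      rw [MonoidHom.inv_apply, Units.val_inv_eq_inv_val, hc, neg_mul, Real.exp_neg,
        Complex.ofReal_inv]⟩

theorem exists_trace_eq_of_idempotent {C : Matrix (Fin d) (Fin d) ℂ} (hC : C * C = C)
    (h0 : C ≠ 0) : ∃ r : ℝ, 0 < r ∧ C.trace = r := by
  have hid : IsIdempotentElem (Matrix.toLin' C) := by
    rw [IsIdempotentElem, Module.End.mul_eq_comp, ← Matrix.toLin'_mul, hC]
  have htr : C.trace = (Module.finrank ℂ (LinearMap.range (Matrix.toLin' C)) : ℂ) := by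
    rw [← Matrix.trace_toLin'_eq, (LinearMap.IsIdempotentElem.isProj_range _ hid).trace]
  refine ⟨_, ?_, htr.trans (Complex.ofReal_natCast _).symm⟩
  rw [Nat.cast_pos, Nat.pos_iff_ne_zero, ne_eq, Submodule.finrank_eq_zero, LinearMap.range_eq_bot]
  simpa using h0

/-- The derivative at `0` of a linear combination of exponentials. -/
theorem hasDerivAt_sum_exp_smul {m κ : Type*} (F : Finset κ) (c : κ → ℝ)
    (C : κ → Matrix m m ℂ) (i j : m) :
    HasDerivAt (fun t : ℝ => (∑ k ∈ F, ((Real.exp (c k * t) : ℝ) : ℂ) • C k) i j)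
      ((∑ k ∈ F, (c k : ℂ) • C k) i j) 0 := by
  simp only [Matrix.sum_apply, Matrix.smul_apply, smul_eq_mul]
  refine HasDerivAt.fun_sum fun k _ => HasDerivAt.mul_const ?_ _
  have h1 : HasDerivAt (fun t : ℝ => Real.exp (c k * t)) (c k) 0 := by
    simpa using ((hasDerivAt_id (0 : ℝ)).const_mul (c k)).exp
  exact h1.ofReal_comp

/-- Not all weights of `ρ` can be nonnegative along a nontrivial one-parameter subgroup: they sum
to zero, with multiplicities, and do not all vanish because `ρ` has finite kernel. -/
theorem exists_weight_neg (hG : IsConnectedSemisimpleQ G) (hTG : T ≤ G)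
    {ρ : G →* GL (Fin d) ℂ} (hρ : IsRationalQ ρ) (hirr : IsIrreducibleRep ρ)
    (hker : (ρ.ker : Set G).Finite) {h : GL (Fin n) ℂ}
    {hd : ∀ t ∈ T, (h * t * h⁻¹).val.IsDiag} {a : ℝ → T} (ha : IsOneParameterSubgroup a)
    (hcoord : ∀ i, ∃ c : ℝ, ∀ t, ((coordChar h hd i (a t) : ℂˣ) : ℂ) = (Real.exp (c * t) : ℝ))
    {F : Finset (T →* ℂˣ)} {C : (T →* ℂˣ) → Matrix (Fin d) (Fin d) ℂ} {c : (T →* ℂˣ) → ℝ}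
    (hsum : ∑ χ ∈ F, C χ = 1)
    (hleft : ∀ χ ∈ F, ∀ t, (ρ (Subgroup.inclusion hTG t)).val * C χ = ((χ t : ℂˣ) : ℂ) • C χ)
    (hidem : ∀ χ ∈ F, C χ * C χ = C χ) (hne : ∀ χ ∈ F, C χ ≠ 0)
    (hc : ∀ χ ∈ F, ∀ t, ((χ (a t) : ℂˣ) : ℂ) = (Real.exp (c χ * t) : ℝ)) :
    ∃ χ ∈ F, c χ < 0 := by
  by_contra! hnn
  have hρa : ∀ t, (ρ (Subgroup.inclusion hTG (a t))).val =
      ∑ χ ∈ F, ((Real.exp (c χ * t) : ℝ) : ℂ) • C χ := by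
    intro t
    rw [← mul_one (ρ _).val, ← hsum, Finset.mul_sum]
    exact Finset.sum_congr rfl fun χ hχ => by rw [hleft χ hχ, hc χ hχ]
  choose e he using hcoord
  have hat : ∀ t, (a t : GL (Fin n) ℂ).val = ∑ i, ((Real.exp (e i * t) : ℝ) : ℂ) •
      (h⁻¹.val * Matrix.single i i 1 * h.val) := by
    intro t
    rw [eq_conj_diagonal_coordChar h hd (a t), ← Matrix.sum_single_eq_diagonal,
      Finset.mul_sum, Finset.sum_mul]
    refine Finset.sum_congr rfl fun i _ => ?_
    rw [he, ← smul_mul_assoc, ← mul_smul_comm, Matrix.smul_single, smul_eq_mul, mul_one]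
  -- the velocity of `t ↦ (a t, ρ (a t))` at `0`
  let A := Matrix.fromBlocks (∑ i, (e i : ℂ) • (h⁻¹.val * Matrix.single i i 1 * h.val)) 0 0
    (∑ χ ∈ F, (c χ : ℂ) • C χ)
  have hA : A ∈ tangentSpace (graphSet ρ) := by
    refine mem_tangentSpace_of_hasDerivAt (𝕜 := ℝ)
      (c := fun t => Matrix.fromBlocks (a t : GL (Fin n) ℂ).val 0 0
        (ρ (Subgroup.inclusion hTG (a t))).val) (fun t => ⟨Subgroup.inclusion hTG (a t), rfl⟩) ?_ ?_
    · simp [ha.map_zero]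
    · simp only [hρa, hat]
      rintro ⟨i | i, j | j⟩
      · exact hasDerivAt_sum_exp_smul Finset.univ e
          (fun i => h⁻¹.val * Matrix.single i i 1 * h.val) i j
      · exact hasDerivAt_const _ _
      · exact hasDerivAt_const _ _
      · exact hasDerivAt_sum_exp_smul _ _ _ i j
  have htr := trace_toBlocks₂₂_eq_zero hG hρ hirr hker hA
  rw [Matrix.toBlocks_fromBlocks₂₂, Matrix.trace_sum] at htr
  have htrC : ∀ χ ∈ F, 0 < (C χ).trace.re ∧ (C χ).trace = ((C χ).trace.re : ℂ) := by
    intro χ hχ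
    obtain ⟨r, hr, hr'⟩ := exists_trace_eq_of_idempotent (hidem χ hχ) (hne χ hχ)
    rw [hr', Complex.ofReal_re]
    exact ⟨hr, rfl⟩
  have htr' : ∑ χ ∈ F, c χ * (C χ).trace.re = 0 := by
    have h1 : ((∑ χ ∈ F, c χ * (C χ).trace.re : ℝ) : ℂ) = 0 := by
      rw [← htr, Complex.ofReal_sum]
      refine Finset.sum_congr rfl fun χ hχ => ?_
      rw [Complex.ofReal_mul, ← (htrC χ hχ).2, Matrix.trace_smul, smul_eq_mul]
    exact_mod_cast h1
  rw [Finset.sum_eq_zero_iff_of_nonneg fun χ hχ => mul_nonneg (hnn χ hχ) (htrC χ hχ).1.le] at htr'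
  have hρ1 : ∀ t, ρ (Subgroup.inclusion hTG (a t)) = 1 := by
    intro t
    ext1
    rw [hρa, Units.val_one, ← hsum]
    refine Finset.sum_congr rfl fun χ hχ => ?_
    rw [(mul_eq_zero.1 (htr' χ hχ)).resolve_right (htrC χ hχ).1.ne']
    simp
  obtain ⟨t, ht⟩ := ha.nontrivial
  have := apply_eq_one_of_ker_finite hker (b := fun t => Subgroup.inclusion hTG (a t))
    (fun s t => by rw [ha.map_add, map_mul]) hρ1 t
  exact ht (Subgroup.inclusion_injective hTG (this.trans (map_one _).symm))

end OneParameter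
end

noncomputable section

/-! ### Roots of the minimal parabolic subgroup -/

section Roots
variable {n d : ℕ} {G T P P' : Subgroup (GL (Fin n) ℂ)}

theorem star_eval {σ : Type*} (x : σ → ℂ) (p : MvPolynomial σ ℂ) :
    starRingEnd ℂ (MvPolynomial.eval x p) =
      MvPolynomial.eval (fun i => starRingEnd ℂ (x i)) (MvPolynomial.map (starRingEnd ℂ) p) := by
  rw [MvPolynomial.eval_map]
  exact MvPolynomial.eval₂_comp_left (starRingEnd ℂ) (RingHom.id ℂ) x p

/-- A set of matrices defined over `ℚ` is stable under complex conjugation. -/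
theorem map_star_mem {S : Set (GL (Fin n) ℂ)} (hS : IsZariskiClosed ℚ S) {g : GL (Fin n) ℂ}
    (hg : g ∈ S) : Matrix.GeneralLinearGroup.map (starRingEnd ℂ) g ∈ S := by
  obtain ⟨I, rfl⟩ := hS
  intro p hp
  have h1 := hg p hp
  rw [aeval_eq_eval_entries] at h1 ⊢
  have h2 := star_eval (entries g.val) (MvPolynomial.map (algebraMap ℚ ℂ) p)
  rw [h1, _root_.map_zero, MvPolynomial.map_map,
    RingHom.ext_rat ((starRingEnd ℂ).comp (algebraMap ℚ ℂ)) (algebraMap ℚ ℂ)] at h2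
  exact h2.symm

/-- The Lie algebra of a group defined over `ℚ` is stable under complex conjugation. -/
theorem map_star_mem_tangentSpace (hP : IsZariskiClosed ℚ (P : Set (GL (Fin n) ℂ)))
    {X : Matrix (Fin n) (Fin n) ℂ}
    (hX : X ∈ tangentSpace (Units.val '' (P : Set (GL (Fin n) ℂ)))) :
    X.map (starRingEnd ℂ) ∈ tangentSpace (Units.val '' (P : Set (GL (Fin n) ℂ))) := by
  intro p hp
  have h1 := hX (MvPolynomial.map (starRingEnd ℂ) p) (by
    rintro _ ⟨g, hg, rfl⟩
    have h2 := hp _ ⟨_, map_star_mem hP hg, rfl⟩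
    have h3 := congrArg (starRingEnd ℂ) h2
    rw [star_eval, _root_.map_zero] at h3
    have h4 : (fun ij => starRingEnd ℂ (entries
        (Matrix.GeneralLinearGroup.map (starRingEnd ℂ) g).val ij)) = entries g.val := by
      ext ij
      simp [entries]
    rwa [h4] at h3)
  have h4 := congrArg (starRingEnd ℂ) h1
  rw [map_sum, _root_.map_zero] at h4
  rw [← h4]
  refine Finset.sum_congr rfl fun ij _ => ?_
  rw [map_mul, star_eval, MvPolynomial.pderiv_map, MvPolynomial.map_map]
  congr 1
  have h5 : (starRingEnd ℂ).comp (starRingEnd ℂ) = RingHom.id ℂ := by ext; simp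
  rw [h5, MvPolynomial.map_id]
  congr 2
  ext ij
  simp only [entries, Matrix.one_apply]
  split_ifs <;> simp

theorem expUnit_mem_of_mem_tangentSpace (hP : IsZariskiClosed ℚ (P : Set (GL (Fin n) ℂ)))
    {X : Matrix (Fin n) (Fin n) ℂ}
    (hX : X ∈ tangentSpace (Units.val '' (P : Set (GL (Fin n) ℂ)))) (s : ℂ) :
    expUnit X s ∈ P := by
  obtain ⟨I, hPI⟩ := hP.exists_eval
  refine (hPI _).2 fun p hp => ?_
  refine eval_exp_eq_zero (S := Units.val '' (P : Set (GL (Fin n) ℂ))) ⟨1, one_mem P, rfl⟩ ?_ hX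
    ?_ s
  · rintro _ ⟨g, hg, rfl⟩ _ ⟨h, hh, rfl⟩
    exact ⟨g * h, mul_mem hg hh, rfl⟩
  · rintro _ ⟨g, hg, rfl⟩
    exact (hPI g).1 hg p hp

open scoped Matrix.Norms.Operator in
theorem isRealPoint_expUnit {Y : Matrix (Fin n) (Fin n) ℂ} (hY : Y.map (starRingEnd ℂ) = Y)
    (s : ℝ) : IsRealPoint (expUnit Y s) := by
  let Y₀ : Matrix (Fin n) (Fin n) ℝ := Y.map Complex.re
  have hY₀ : Complex.ofRealHom.mapMatrix (s • Y₀) = (s : ℂ) • Y := by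
    ext i j
    have h1 := congrFun (congrFun hY i) j
    simp only [RingHom.mapMatrix_apply, Matrix.map_apply, Matrix.smul_apply, smul_eq_mul, Y₀,
      Complex.ofRealHom_eq_coe, Complex.ofReal_mul]
    rw [Complex.conj_eq_iff_re.1 h1]
  have hcont : Continuous (Complex.ofRealHom.mapMatrix (m := Fin n)) :=
    Continuous.matrix_map continuous_id Complex.continuous_ofReal
  refine ⟨(Matrix.isUnit_exp (s • Y₀)).unit, ?_⟩
  ext1
  exact (NormedSpace.map_exp Complex.ofRealHom.mapMatrix hcont (s • Y₀)).trans
    (congrArg NormedSpace.exp hY₀)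

open scoped Matrix.Norms.Operator in
theorem tendsto_expUnit {l : Filter ℝ} {Y : ℝ → Matrix (Fin n) (Fin n) ℂ}
    (hY : Tendsto Y l (𝓝 0)) (s : ℂ) : Tendsto (fun t => expUnit (Y t) s) l (𝓝 1) := by
  have h1 : Tendsto (fun t => (expUnit (Y t) s).val) l (𝓝 (1 : GL (Fin n) ℂ).val) := by
    have h2 : Continuous fun X : Matrix (Fin n) (Fin n) ℂ => NormedSpace.exp (s • X) :=
      NormedSpace.exp_continuous.comp (continuous_const_smul s)
    have h3 := (h2.tendsto 0).comp hY
    rw [smul_zero, NormedSpace.exp_zero] at h3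
    exact h3
  exact (Units.isOpenEmbedding_val (R := Matrix (Fin n) (Fin n) ℂ)).isInducing.tendsto_nhds_iff.2 h1

theorem conj_expUnit (g : GL (Fin n) ℂ) (Y : Matrix (Fin n) (Fin n) ℂ) (s : ℂ) :
    g * expUnit Y s * g⁻¹ = expUnit (g.val * Y * g⁻¹.val) s := by
  ext1
  change g.val * NormedSpace.exp (s • Y) * g⁻¹.val = NormedSpace.exp (s • (g.val * Y * g⁻¹.val))
  rw [← Matrix.exp_units_conj]
  simp

theorem unipotentRadical_le (P : Subgroup (GL (Fin n) ℂ)) : unipotentRadical P ≤ P :=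
  sSup_le fun _ hU => hU.1.1

theorem IsOneParameterSubgroup.map_star {a : ℝ → T} (ha : IsOneParameterSubgroup a) (t : ℝ) :
    (a t : GL (Fin n) ℂ).val.map (starRingEnd ℂ) = (a t : GL (Fin n) ℂ).val := by
  obtain ⟨g₀, hg₀⟩ := ha.real t
  rw [← hg₀]
  ext i j
  simp

/-- The absolute value of a root along the one-parameter group is an exponential function. -/
theorem exists_norm_root_eq_exp {a : ℝ → T} (ha : IsOneParameterSubgroup a) {α : T →* ℂˣ}
    (hα : α ∈ rootsIn T P) : ∃ c : ℝ, ∀ t, ‖((α (a t) : ℂˣ) : ℂ)‖ = Real.exp (c * t) := by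
  obtain ⟨-, X, -, hX0, hX⟩ := hα
  obtain ⟨i, j, hij⟩ : ∃ i j, X i j ≠ 0 := by
    by_contra! h
    exact hX0 (Matrix.ext h)
  refine exists_eq_exp_mul (f := fun t => ‖((α (a t) : ℂˣ) : ℂ)‖) ?_ (fun t => by simp) ?_
  · have h1 : (fun t => ‖((α (a t) : ℂˣ) : ℂ)‖) = fun t =>
        ‖((a t : GL (Fin n) ℂ).val * X * (a (-t) : GL (Fin n) ℂ).val) i j / X i j‖ := by
      ext t
      have h2 := congrFun (congrFun (hX (a t)) i) j
      rw [← Subgroup.coe_inv, ha.inv_eq] at h2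
      rw [h2, Matrix.smul_apply, smul_eq_mul, mul_div_cancel_right₀ _ hij]
    rw [h1]
    exact ((((ha.continuous_val.mul continuous_const).mul
      (ha.continuous_val.comp continuous_neg)).matrix_elem i j).div_const _).norm
  · intro s t
    simp [ha.map_add]

/-- The roots of `P` do not grow along `a t` for `t ≥ 0`. A real root vector `Y` in the Lie algebra
of `P` that contracts to zero along `a t` as `t → -∞` exponentiates into the unstable horospherical
subgroup, hence into the opposite parabolic subgroup and so into the centralizer of `T`; but then it
is fixed by `a t`. -/
theorem norm_root_le_one (hP : IsZariskiClosed ℚ (P : Set (GL (Fin n) ℂ))) (hPG : P ≤ G)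
    (hPP' : P ⊓ P' = centralizerIn G T) {a : ℝ → T} (ha : IsOneParameterSubgroup a)
    (hunstable : horospherical G a atBot ⊆ unipotentRadical P') {α : T →* ℂˣ}
    (hα : α ∈ rootsIn T P) {t : ℝ} (ht : 0 ≤ t) : ‖((α (a t) : ℂˣ) : ℂ)‖ ≤ 1 := by
  obtain ⟨c, hc⟩ := exists_norm_root_eq_exp ha hα
  suffices hc0 : c ≤ 0 by
    rw [hc]
    exact Real.exp_le_one_iff.2 (mul_nonpos_of_nonpos_of_nonneg hc0 ht)
  by_contra! hc0
  obtain ⟨-, X, hXP, hX0, hX⟩ := hα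
  have hXt : X ∈ tangentSpace (Units.val '' (P : Set (GL (Fin n) ℂ))) := by
    intro p hp
    exact hXP p fun g hg => hp _ ⟨g, hg, rfl⟩
  set X' := X.map (starRingEnd ℂ) with hX'
  have hXt' := map_star_mem_tangentSpace hP hXt
  have hXa' : ∀ t, (a t : GL (Fin n) ℂ).val * X' * (a t : GL (Fin n) ℂ)⁻¹.val =
      starRingEnd ℂ ((α (a t) : ℂˣ) : ℂ) • X' := by
    intro t
    have h1 := congrArg (fun M => Matrix.map M (starRingEnd ℂ)) (hX (a t))
    simp only [Matrix.map_mul, ha.map_star] at h1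
    rw [← Subgroup.coe_inv, ha.inv_eq, ha.map_star, ← ha.inv_eq, Subgroup.coe_inv] at h1
    rw [h1]
    ext i j
    simp [hX']
  have hlim : Tendsto (fun t => ((α (a t) : ℂˣ) : ℂ)) atBot (𝓝 0) := by
    rw [tendsto_zero_iff_norm_tendsto_zero]
    simp only [hc]
    exact Real.tendsto_exp_atBot.comp (tendsto_id.const_mul_atBot hc0)
  have hlim' : Tendsto (fun t => starRingEnd ℂ ((α (a t) : ℂˣ) : ℂ)) atBot (𝓝 0) := by
    have h1 := (Complex.continuous_conj.tendsto 0).comp hlim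
    rw [_root_.map_zero] at h1
    exact h1
  have key : ∀ z : ℂ, z • X + starRingEnd ℂ z • X' = 0 := by
    intro z
    set Y := z • X + starRingEnd ℂ z • X' with hY
    have hYt : Y ∈ tangentSpace (Units.val '' (P : Set (GL (Fin n) ℂ))) :=
      add_mem (Submodule.smul_mem _ _ hXt) (Submodule.smul_mem _ _ hXt')
    have hYstar : Y.map (starRingEnd ℂ) = Y := by
      ext i j
      simp [hY, hX', add_comm]
    have hYlim : Tendsto (fun t => (a t : GL (Fin n) ℂ).val * Y * (a t : GL (Fin n) ℂ)⁻¹.val)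
        atBot (𝓝 0) := by
      have h1 : ∀ t, (a t : GL (Fin n) ℂ).val * Y * (a t : GL (Fin n) ℂ)⁻¹.val =
          z • ((α (a t) : ℂˣ) : ℂ) • X +
            starRingEnd ℂ z • starRingEnd ℂ ((α (a t) : ℂˣ) : ℂ) • X' := by
        intro t
        rw [hY, mul_add, add_mul, mul_smul_comm, smul_mul_assoc, hX, mul_smul_comm,
          smul_mul_assoc, hXa']
      simp only [h1]
      have h2 := ((hlim.smul_const X).const_smul z).add
        ((hlim'.smul_const X').const_smul (starRingEnd ℂ z))
      simpa using h2
    refine eq_zero_of_exp_real_smul_eq_one fun s => ?_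
    have hEP : expUnit Y s ∈ P := expUnit_mem_of_mem_tangentSpace hP hYt s
    have hElim : Tendsto (fun t => (a t : GL (Fin n) ℂ) * expUnit Y s * (a t : GL (Fin n) ℂ)⁻¹)
        atBot (𝓝 1) := by
      simp only [conj_expUnit]
      exact tendsto_expUnit hYlim s
    have hEP' : expUnit Y s ∈ P' := unipotentRadical_le P'
      (hunstable ⟨hPG hEP, isRealPoint_expUnit hYstar s, hElim⟩)
    have hEc : expUnit Y s ∈ centralizerIn G T := hPP' ▸ ⟨hEP, hEP'⟩
    have hfix : ∀ t, (a t : GL (Fin n) ℂ) * expUnit Y s * (a t : GL (Fin n) ℂ)⁻¹ =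
        expUnit Y s := by
      intro t
      rw [Subgroup.mem_centralizer_iff.1 hEc.2 _ (a t).2, mul_inv_cancel_right]
    simp only [hfix] at hElim
    exact congrArg Units.val (tendsto_nhds_unique tendsto_const_nhds hElim)
  have h1 := key 1
  have h2 := key Complex.I
  rw [map_one, one_smul, one_smul] at h1
  rw [Complex.conj_I, neg_smul, ← sub_eq_add_neg, ← smul_sub] at h2
  have h3 := (smul_eq_zero.1 h2).resolve_left Complex.I_ne_zero
  refine hX0 ?_
  have h4 : (2 : ℂ) • X = 0 := by
    have := congrArg₂ (· + ·) h1 h3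
    simpa [two_smul] using this
  exact (smul_eq_zero.1 h4).resolve_left two_ne_zero

theorem norm_le_one_of_mem_closure {Φ : Set (T →* ℂˣ)} {t : T}
    (hΦ : ∀ α ∈ Φ, ‖((α t : ℂˣ) : ℂ)‖ ≤ 1) {χ : T →* ℂˣ} (hχ : χ ∈ Submonoid.closure Φ) :
    ‖((χ t : ℂˣ) : ℂ)‖ ≤ 1 := by
  induction hχ using Submonoid.closure_induction with
  | mem χ hχ => exact hΦ χ hχ
  | one => simp
  | mul χ χ' _ _ h₁ h₂ =>
    rw [MonoidHom.mul_apply, Units.val_mul, norm_mul]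
    exact mul_le_one₀ h₁ (norm_nonneg _) h₂

end Roots

/-! ### Norms of lattice vectors -/

section Lattice
variable {n d : ℕ} {G T : Subgroup (GL (Fin n) ℂ)}

theorem zero_le_tau {ψ : ℝ → ℝ} (hpos : ∀ t, 0 < t → 0 < ψ t) (hbdd : ∃ M : ℝ, ∀ t, 0 < t → ψ t ≤ M) :
    0 ≤ tau ψ := by
  obtain ⟨M, hM⟩ := hbdd
  have h1 : Tendsto (fun t : ℝ => ((-(Real.log M / t) : ℝ) : EReal)) atTop (𝓝 0) := by
    have h2 : Tendsto (fun t : ℝ => -(Real.log M / t)) atTop (𝓝 0) := by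
      simpa using ((tendsto_const_nhds (x := Real.log M)).div_atTop (tendsto_id (α := ℝ))).neg
    exact (continuous_coe_real_ereal.tendsto 0).comp h2
  rw [← h1.liminf_eq]
  refine liminf_le_liminf ?_
  filter_upwards [eventually_gt_atTop 0] with t ht
  rw [EReal.coe_le_coe_iff, neg_le_neg_iff]
  exact div_le_div_of_nonneg_right (Real.log_le_log (hpos t ht) (hM t ht)) ht.le

/-- Linear maps are bounded with respect to any norm on a finite-dimensional space. -/
theorem exists_norm_le_mul_of_definite (N : Seminorm ℂ (Fin d → ℂ)) (hN : ∀ v, N v = 0 → v = 0)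
    (f : (Fin d → ℂ) →ₗ[ℂ] (Fin d → ℂ)) : ∃ K : ℝ, 0 ≤ K ∧ ∀ v, ‖f v‖ ≤ K * N v := by
  have main : ∀ (E F : Type) [NormedAddCommGroup E] [NormedSpace ℂ E] [FiniteDimensional ℂ E]
      [NormedAddCommGroup F] [NormedSpace ℂ F] (f : E →ₗ[ℂ] F),
      ∃ K : ℝ, 0 ≤ K ∧ ∀ v, ‖f v‖ ≤ K * ‖v‖ := fun E F _ _ _ _ _ f =>
    ⟨‖f.toContinuousLinearMap‖, norm_nonneg _, f.toContinuousLinearMap.le_opNorm⟩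
  let inst : NormedAddCommGroup (Fin d → ℂ) := AddGroupNorm.toNormedAddCommGroup
    { N.toAddGroupSeminorm with eq_zero_of_map_eq_zero' := fun v => hN v }
  let inst' : @NormedSpace ℂ (Fin d → ℂ) _ inst.toSeminormedAddCommGroup :=
    @NormedSpace.mk _ _ _ inst.toSeminormedAddCommGroup _ fun c v => (map_smul_eq_mul N c v).le
  exact @main (Fin d → ℂ) (Fin d → ℂ) inst inst' inferInstance Pi.normedAddCommGroup
    Pi.normedSpace f

/-- If all weights of `ρ` are at least `-b`, then the first minimum of the lattice `a t * g * ℤ^d`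
is bounded below by a multiple of `exp (-b * t)`. -/
theorem exists_le_firstMin (hTG : T ≤ G) {ρ : G →* GL (Fin d) ℂ} (hd : 0 < d) {a : ℝ → T}
    {F : Finset (T →* ℂˣ)} {C : (T →* ℂˣ) → Matrix (Fin d) (Fin d) ℂ} {c : (T →* ℂˣ) → ℝ}
    (hsum : ∑ χ ∈ F, C χ = 1)
    (hright : ∀ χ ∈ F, ∀ t, C χ * (ρ (Subgroup.inclusion hTG t)).val = ((χ t : ℂˣ) : ℂ) • C χ)
    (hc : ∀ χ ∈ F, ∀ t, ((χ (a t) : ℂˣ) : ℂ) = (Real.exp (c χ * t) : ℝ))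
    {b : ℝ} (hb : ∀ χ ∈ F, -b ≤ c χ)
    (N : Seminorm ℂ (Fin d → ℂ)) (hN : ∀ v, N v = 0 → v = 0) (g : G) :
    ∃ K : ℝ, 0 < K ∧ ∀ t, 0 ≤ t →
      Real.exp (-b * t) / K ≤ firstMin N (latticeImage (ρ (Subgroup.inclusion hTG (a t) * g))) := by
  choose K hK0 hK using fun χ => exists_norm_le_mul_of_definite N hN
    (Matrix.toLin' ((ρ g)⁻¹.val * C χ))
  have hK0' : 0 ≤ ∑ χ ∈ F, K χ := Finset.sum_nonneg fun χ _ => hK0 χ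
  refine ⟨∑ χ ∈ F, K χ + 1, by positivity, fun t ht => ?_⟩
  refine le_csInf ?_ ?_
  · refine Set.Nonempty.image _ ⟨_, ⟨Pi.single ⟨0, hd⟩ 1, rfl⟩, ?_⟩
    intro h0
    rw [Set.mem_singleton_iff] at h0
    have h1 := congrArg (Matrix.mulVec (ρ (Subgroup.inclusion hTG (a t) * g))⁻¹.val) h0
    rw [Matrix.mulVec_mulVec, Units.inv_mul, Matrix.one_mulVec, Matrix.mulVec_zero] at h1
    have h2 := congrFun h1 ⟨0, hd⟩
    simp at h2
  · rintro _ ⟨_, ⟨⟨m, rfl⟩, hm⟩, rfl⟩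
    set v : Fin d → ℂ := fun i => (m i : ℂ) with hv
    set u := (ρ (Subgroup.inclusion hTG (a t) * g)).val.mulVec v with hu
    have hnorm : 1 ≤ ‖v‖ := by
      have : ∃ i, m i ≠ 0 := by
        by_contra! h
        refine hm ?_
        have : v = 0 := by ext i; simp [hv, h i]
        rw [Set.mem_singleton_iff]
        change Matrix.mulVec _ v = 0
        rw [this, Matrix.mulVec_zero]
      obtain ⟨i, hi⟩ := this
      refine le_trans ?_ (norm_le_pi_norm v i)
      rw [hv, Complex.norm_intCast]
      exact_mod_cast Int.one_le_abs hi
    -- `v` is recovered from `u` through the weight projections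
    have hvu : v = ∑ χ ∈ F, ((Real.exp (-(c χ * t)) : ℝ) : ℂ) •
        ((ρ g)⁻¹.val * C χ).mulVec u := by
      have h1 : ∀ χ ∈ F, ((Real.exp (-(c χ * t)) : ℝ) : ℂ) • ((ρ g)⁻¹.val * C χ).mulVec u =
          ((ρ g)⁻¹.val * C χ * (ρ g).val).mulVec v := by
        intro χ hχ
        rw [hu, Matrix.mulVec_mulVec, map_mul, Units.val_mul, ← mul_assoc, mul_assoc _ (C χ),
          hright χ hχ, hc χ hχ, mul_smul_comm, smul_mul_assoc, Matrix.smul_mulVec, smul_smul,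
          ← Complex.ofReal_mul, ← Real.exp_add, neg_add_cancel, Real.exp_zero, Complex.ofReal_one,
          one_smul]
      rw [Finset.sum_congr rfl h1, ← Matrix.sum_mulVec, ← Finset.sum_mul, ← Finset.mul_sum, hsum,
        mul_one, Units.inv_mul, Matrix.one_mulVec]
    have hle : ‖v‖ ≤ Real.exp (b * t) * (∑ χ ∈ F, K χ) * N u := by
      rw [hvu, mul_assoc, Finset.sum_mul, Finset.mul_sum]
      refine (norm_sum_le _ _).trans (Finset.sum_le_sum fun χ hχ => ?_)
      rw [norm_smul, Complex.norm_real, Real.norm_eq_abs, Real.abs_exp]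
      refine mul_le_mul (Real.exp_le_exp.2 ?_) (hK χ u) (norm_nonneg _) (Real.exp_pos _).le
      nlinarith [hb χ hχ]
    rw [div_le_iff₀ (by positivity), neg_mul, Real.exp_neg,
      inv_le_iff_one_le_mul₀ (Real.exp_pos _)]
    have hNu : 0 ≤ N u := apply_nonneg N u
    have hexp := Real.exp_pos (b * t)
    nlinarith [mul_nonneg hexp.le hNu]

theorem mem_of_mem_weights (hTG : T ≤ G) {ρ : G →* GL (Fin d) ℂ}
    {F : Finset (T →* ℂˣ)} {C : (T →* ℂˣ) → Matrix (Fin d) (Fin d) ℂ} (hsum : ∑ χ ∈ F, C χ = 1)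
    (hright : ∀ χ ∈ F, ∀ t, C χ * (ρ (Subgroup.inclusion hTG t)).val = ((χ t : ℂˣ) : ℂ) • C χ)
    {β : T →* ℂˣ} (hβ : β ∈ weights hTG ρ) : β ∈ F := by
  obtain ⟨v, hv0, hv⟩ := hβ
  obtain ⟨χ, hχ, hχv⟩ : ∃ χ ∈ F, (C χ).mulVec v ≠ 0 := by
    by_contra! h
    refine hv0 ?_
    rw [← Matrix.one_mulVec v, ← hsum, Matrix.sum_mulVec]
    exact Finset.sum_eq_zero h
  have : β = χ := by
    ext t
    have h1 := congrArg (Matrix.mulVec (C χ)) (hv t)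
    rw [Matrix.mulVec_mulVec, hright χ hχ, Matrix.smul_mulVec, Matrix.mulVec_smul] at h1
    exact (smul_left_injective ℂ hχv h1).symm
  rwa [this]

theorem mem_weights_of_mul_eq_smul (hTG : T ≤ G) {ρ : G →* GL (Fin d) ℂ} {χ : T →* ℂˣ}
    {C : Matrix (Fin d) (Fin d) ℂ} (h0 : C ≠ 0)
    (hleft : ∀ t, (ρ (Subgroup.inclusion hTG t)).val * C = ((χ t : ℂˣ) : ℂ) • C) :
    χ ∈ weights hTG ρ := by
  obtain ⟨i, hi⟩ : ∃ i, C.mulVec (Pi.single i 1) ≠ 0 := by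
    by_contra! h
    refine h0 (Matrix.ext_of_mulVec_single fun i => ?_)
    rw [h, Matrix.zero_mulVec]
  exact ⟨_, hi, fun t => by rw [Matrix.mulVec_mulVec, hleft, Matrix.smul_mulVec]⟩

end Lattice
end

theorem theorem1p3 {n d : ℕ} (G T P₀ P₀' : Subgroup (GL (Fin n) ℂ))
    (hG : IsConnectedSemisimpleQ G)
    (hT : IsMaximalSplitTorusQ G T)
    (a : ℝ → T) (ha : IsOneParameterSubgroup a)
    (hP₀ : IsMinimalParabolicQ G P₀) (hTP₀ : T ≤ P₀)
    (hP₀' : IsOppositeMinimalParabolicQ G T P₀ P₀')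
    (hstable : horospherical G a Filter.atTop ⊆ unipotentRadical P₀)
    (hunstable : horospherical G a Filter.atBot ⊆ unipotentRadical P₀')
    (ρ : G →* GL (Fin d) ℂ) (hρQ : IsRationalQ ρ) (hρirr : IsIrreducibleRep ρ)
    (hρker : (ρ.ker : Set G).Finite)
    (β₀ : T →* ℂˣ) (hβ₀ : IsHighestWeight hT.2.1 ρ (rootsIn T P₀) β₀)
    (N : Seminorm ℂ (Fin d → ℂ)) (hN : ∀ v, N v = 0 → v = 0)
    (ψ : ℝ → ℝ) (hψpos : ∀ t, 0 < t → 0 < ψ t) (hψbdd : ∃ M : ℝ, ∀ t, 0 < t → ψ t ≤ M) :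
    0 ≤ tau ψ ∧ 0 < charValue β₀ (a (-1)) ∧
      ((charValue β₀ (a (-1)) : EReal) < tau ψ →
        realPoints G \ diophantineSet hT.2.1 ρ N a ψ = ∅) := by
  obtain ⟨H, hd⟩ := hT.1.diagonalizable
  have hTG := hT.2.1
  obtain ⟨F, C, hsum, hleft, hright, hidem, hne, hmem⟩ :=
    exists_weight_projections _ hd hTG hρQ
  have hcoord := exists_coordChar_eq_exp H hd ha
  have hex : ∀ χ, ∃ c : ℝ, χ ∈ F → ∀ t, ((χ (a t) : ℂˣ) : ℂ) = (Real.exp (c * t) : ℝ) := by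
    intro χ
    by_cases hχ : χ ∈ F
    · obtain ⟨c, hc⟩ := exists_eq_exp_of_mem_closure hcoord (hmem χ hχ)
      exact ⟨c, fun _ => hc⟩
    · exact ⟨0, fun h => absurd h hχ⟩
  choose c hc using hex
  have hβF : β₀ ∈ F := mem_of_mem_weights hTG hsum hright hβ₀.1
  -- the highest weight decays fastest, because the positive roots do not grow
  have hmin : ∀ χ ∈ F, c β₀ ≤ c χ := by
    intro χ hχ
    have hw := mem_weights_of_mul_eq_smul hTG (hne χ hχ) (hleft χ hχ)
    have h1 := norm_le_one_of_mem_closure (t := a 1) (fun α hα =>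
      norm_root_le_one hP₀.1.2.1 hP₀.1.1 hP₀'.2 ha hunstable hα zero_le_one) (hβ₀.2 χ hw)
    rw [MonoidHom.div_apply, Units.val_div_eq_div_val, hc β₀ hβF, hc χ hχ, norm_div,
      Complex.norm_real, Complex.norm_real, Real.norm_eq_abs, Real.norm_eq_abs, Real.abs_exp,
      Real.abs_exp, ← Real.exp_sub, Real.exp_le_one_iff] at h1
    linarith
  obtain ⟨χ, hχ, hχneg⟩ := exists_weight_neg hG hTG hρQ hρirr hρker ha hcoord hsum hleft hidem
    hne hc
  have hval : charValue β₀ (a (-1)) = -c β₀ := by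
    rw [charValue, hc β₀ hβF, Complex.norm_real, Real.norm_eq_abs, Real.abs_exp, Real.log_exp]
    ring
  have hpos : 0 < charValue β₀ (a (-1)) := by
    rw [hval]
    linarith [hmin χ hχ]
  refine ⟨zero_le_tau hψpos hψbdd, hpos, fun hτ => ?_⟩
  rw [hval] at hτ hpos
  set b := -c β₀ with hb
  rw [Set.sdiff_eq_empty]
  intro g hg
  refine ⟨hg, ?_⟩
  obtain ⟨K, hK, hmin'⟩ := exists_le_firstMin hTG hρirr.1 hsum hright hc (b := b)
    (fun χ hχ => by rw [hb, neg_neg]; exact hmin χ hχ) N hN g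
  obtain ⟨M, hM⟩ := hψbdd
  obtain ⟨t₀, ht₀⟩ := eventually_atTop.1 (eventually_lt_of_lt_liminf hτ)
  -- `ψ` is at most `L * exp (-b * t)`: beyond `t₀` by the growth condition, before it by boundedness
  set L := max 1 (M * Real.exp (b * t₀)) with hL
  have hL0 : 0 < L := lt_of_lt_of_le one_pos (le_max_left _ _)
  have hψL : ∀ t, 0 < t → ψ t ≤ L * Real.exp (-b * t) := by
    intro t ht
    rcases le_total t₀ t with h | h
    · have h1 := ht₀ t h
      rw [EReal.coe_lt_coe_iff, lt_neg, div_lt_iff₀ ht, Real.log_lt_iff_lt_exp (hψpos t ht)] at h1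
      refine h1.le.trans (le_mul_of_one_le_left (Real.exp_pos _).le (le_max_left _ _))
    · have hM0 : 0 ≤ M := (hψpos t ht).le.trans (hM t ht)
      calc ψ t ≤ M * 1 := by rw [mul_one]; exact hM t ht
        _ ≤ M * Real.exp (b * t₀ + -b * t) := by
          refine mul_le_mul_of_nonneg_left (Real.one_le_exp ?_) hM0
          nlinarith
        _ = M * Real.exp (b * t₀) * Real.exp (-b * t) := by rw [Real.exp_add, mul_assoc]
        _ ≤ L * Real.exp (-b * t) :=
          mul_le_mul_of_nonneg_right (le_max_right _ _) (Real.exp_pos _).le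
  refine ⟨1 / (L * K), by positivity, fun t ht => ?_⟩
  refine le_trans ?_ (hmin' t ht.le)
  rw [div_mul_eq_mul_div, one_mul, div_le_div_iff₀ (by positivity) hK]
  calc ψ t * K ≤ L * Real.exp (-b * t) * K := mul_le_mul_of_nonneg_right (hψL t ht) hK.le
    _ = Real.exp (-b * t) * (L * K) := by ring
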